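/- Let $k\in\mathbb N$ and let $(\Lambda,d)$ be a compactly aligned topological $k$-graph. Then its boundary-path groupoid $\mathcal G_\Lambda$ is essentially free if and only if $\Lambda$ satisfies the aperiodicity condition $$\text{(A)}\qquad\text{for every nonempty open } V\subset\Lambda^0 \text{ there is an aperiodic boundary path } x\in\partial\Lambda \text{ with } r(x)\in V.$$ Here the terms have the following meaning. A \emph{topological $k$-graph} is a small category $\Lambda$ with range (codomain) and source (domain) maps $r,s$ and a functor $d:\Lambda\to\mathbb N^k$ such that: the object set $\Lambda^0$ and the morphism set $\Lambda$ are second-countable locally compact Hausdorff spaces; $r,s$ are continuous and $s$ is a local homeomorphism; composition, on the space of composable pairs with the relative product topology, is continuous and open; $d$ is continuous ($\mathbb N^k$ discrete); and whenever $d(\lambda)=m+n$ there is a unique composable pair $(\xi,\eta)$ with $\lambda=\xi\eta$, $d(\xi)=m$, $d(\eta)=n$. Write $\Lambda^m=d^{-1}(m)$, $\vee$ for coordinatewise maximum, $\Lambda*_s\Lambda=\{(\lambda,\mu): s(\lambda)=s(\mu)\}$ and $U*_sV=(U\times V)\cap(\Lambda*_s\Lambda)$. $\Lambda$ is \emph{compactly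 aligned} if for all $p,q\in\mathbb N^k$ and compact $U\subset\Lambda^p$, $V\subset\Lambda^q$, the set $U\Lambda^{(p\vee q)-p}\cap V\Lambda^{(p\vee q)-q}$ is compact. For $m\in(\mathbb N\cup\{\infty\})^k$ let $\Omega_{k,m}$ be the discrete $k$-graph with objects $\{p\in\mathbb N^k:p\le m\}$, morphisms $\{(p,q)\in\mathbb N^k\times\mathbb N^k:p\le q\le m\}$, $r(p,q)=p$, $s(p,q)=q$, $(n,p)(p,q)=(n,q)$ and $d(p,q)=q-p$. The path space $X_\Lambda$ is the set of all continuous degree-preserving functors $x:\Omega_{k,m}\to\Lambda$, $m\in(\mathbb N\cup\{\infty\})^k$; put $d(x)=m$ and $r(x)=x(0)$. For $p\in\mathbb N^k$ with $p\le d(x)$, $\sigma^px\in X_\Lambda$ is the path of degree $d(x)-p$ with $(\sigma^px)(a,b)=x(p+a,p+b)$. For $\lambda\in\Lambda$ with $s(\lambda)=r(x)$, $\lambda x\in X_\Lambda$ is the path with $d(\lambda x)=d(\lambda)+d(x)$, $(\lambda x)(0,d(\lambda))=\lambda$ and $\sigma^{d(\lambda)}(\lambda x)=x$. The path groupoid $G_\Lambda$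 is the set of all $(x,n,y)\in X_\Lambda\times\mathbb Z^k\times X_\Lambda$ for which there are $p,q\in\mathbb N^k$ with $p\le d(x)$, $q\le d(y)$, $p-q=n$ and $\sigma^px=\sigma^qy$, with range $x$, source $y$, product $(x,m,y)(y,n,z)=(x,m+n,z)$ and inverse $(x,n,y)^{-1}=(y,-n,x)$. For $F\subset\Lambda*_s\Lambda$ and $m\in\mathbb Z^k$ put $$Z(F,m)=\{(\lambda x,d(\lambda)-d(\mu),\mu x): (\lambda,\mu)\in F,\ d(\lambda)-d(\mu)=m,\ x\in X_\Lambda,\ r(x)=s(\lambda)\};$$ $G_\Lambda$ carries the topology generated by the sets $Z(U*_sV,m)\setminus Z(F,m)$ with $m\in\mathbb Z^k$, $U,V\subset\Lambda$ open and $F\subset\Lambda*_s\Lambda$ compact. For $\lambda,\mu\in\Lambda$ let $\Lambda^{\min}(\lambda,\mu)=\{(\alpha,\beta):\lambda\alpha=\mu\beta,\ d(\lambda\alpha)=d(\lambda)\vee d(\mu)\}$. For $v\in\Lambda^0$ let $v\mathcal{CE}(\Lambda)$ be the set of compact $E\subset\Lambda$ such that $r(E)$ is a neighbourhood of $v$ and,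 for every $\lambda\in\Lambda$ with $r(\lambda)\in r(E)$, there is $\mu\in E$ with $\Lambda^{\min}(\lambda,\mu)\ne\emptyset$. A path $x\in X_\Lambda$ is a \emph{boundary path} if for all $m\in\mathbb N^k$ with $m\le d(x)$ and all $E\in x(m)\mathcal{CE}(\Lambda)$ there is $\lambda\in E$ with $m+d(\lambda)\le d(x)$ and $x(m,m+d(\lambda))=\lambda$; $\partial\Lambda$ is the set of boundary paths. The boundary-path groupoid $\mathcal G_\Lambda$ is the reduction $G_\Lambda|_{\partial\Lambda}$, the set of elements of $G_\Lambda$ with range and source in $\partial\Lambda$, with the relative topology. A boundary path $x$ is \emph{aperiodic} if $\sigma^px\ne\sigma^qx$ for all $p,q\in\mathbb N^k$ with $p,q\le d(x)$ and $p\ne q$. A groupoid $\Gamma$ with a topology is \emph{essentially free} if $\{x\in\Gamma^{(0)}: x\Gamma x=\{x\}\}$ is dense in the unit space $\Gamma^{(0)}$ (with the relative topology). -/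

import Mathlib

open Topology

universe u v u₁ v₁

set_option linter.checkUnivs false

/-- A topological `k`-graph `(Λ, d)`: a small category `Λ = (Obj, Mor, r, s)`, with range (codomain)
map `r`, source (domain) map `s` and composition `a b` defined when `s a = r b`, together with a
degree functor `d` to the monoid `ℕ^k` and topologies on `Obj` and `Mor`. -/
structure TopologicalKGraph (k : ℕ) where
  /-- the vertices -/
  Obj : Type u
  /-- the (finite) paths -/
  Mor : Type v
  /-- the range map -/
  r : Mor → Obj
  /-- the source map -/
  s : Mor → Obj
  /-- the identity morphisms -/
  ident : Obj → Mor
  /-- composition of composable pairs -/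
  comp : (a b : Mor) → s a = r b → Mor
  r_ident : ∀ x, r (ident x) = x
  s_ident : ∀ x, s (ident x) = x
  r_comp : ∀ a b (h : s a = r b), r (comp a b h) = r a
  s_comp : ∀ a b (h : s a = r b), s (comp a b h) = s b
  ident_comp : ∀ a, comp (ident (r a)) a (s_ident _) = a
  comp_ident : ∀ a, comp a (ident (s a)) (r_ident _).symm = a
  assoc : ∀ a b c (hab : s a = r b) (hbc : s b = r c),
    comp (comp a b hab) c ((s_comp a b hab).trans hbc)
      = comp a (comp b c hbc) (hab.trans (r_comp b c hbc).symm)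
  /-- the degree map -/
  d : Mor → Fin k → ℕ
  d_ident : ∀ x, d (ident x) = 0
  d_comp : ∀ a b (h : s a = r b), d (comp a b h) = d a + d b
  [topObj : TopologicalSpace Obj]
  [topMor : TopologicalSpace Mor]
  [secondCountableObj : SecondCountableTopology Obj]
  [secondCountableMor : SecondCountableTopology Mor]
  [locallyCompactObj : LocallyCompactSpace Obj]
  [locallyCompactMor : LocallyCompactSpace Mor]
  [hausdorffObj : T2Space Obj]
  [hausdorffMor : T2Space Mor]
  continuous_r : Continuous r
  continuous_s : Continuous s
  isLocalHomeomorph_s : IsLocalHomeomorph s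
  continuous_comp : Continuous fun p : {p : Mor × Mor // s p.1 = r p.2} => comp p.1.1 p.1.2 p.2
  isOpenMap_comp : IsOpenMap fun p : {p : Mor × Mor // s p.1 = r p.2} => comp p.1.1 p.1.2 p.2
  continuous_d : Continuous d
  /-- the factorisation property -/
  factorisation : ∀ (a : Mor) (m n : Fin k → ℕ), d a = m + n →
    ∃! p : Mor × Mor, ∃ h : s p.1 = r p.2, comp p.1 p.2 h = a ∧ d p.1 = m ∧ d p.2 = n

namespace TopologicalKGraph

attribute [instance] topObj topMor secondCountableObj secondCountableMor locallyCompactObj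
  locallyCompactMor hausdorffObj hausdorffMor

variable {k : ℕ}

section Graph

variable (Λ : TopologicalKGraph.{u, v} k)

/-- `Λ^m`, the paths of degree `m`. -/
def paths (m : Fin k → ℕ) : Set Λ.Mor := {a | Λ.d a = m}

/-- `Λ *_s Λ`, the pairs of paths with common source. -/
def sourcePairs : Set (Λ.Mor × Λ.Mor) := {p | Λ.s p.1 = Λ.s p.2}

/-- `U *_s V = (U × V) ∩ (Λ *_s Λ)`. -/
def starS (U V : Set Λ.Mor) : Set (Λ.Mor × Λ.Mor) := (U ×ˢ V) ∩ Λ.sourcePairs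

/-- `U V`, the set of composites `a b` of composable `a ∈ U` and `b ∈ V`. -/
def setComp (U V : Set Λ.Mor) : Set Λ.Mor :=
  {c | ∃ a ∈ U, ∃ b ∈ V, ∃ h : Λ.s a = Λ.r b, Λ.comp a b h = c}

/-- `U ∨ V = U Λ^{(p ∨ q) - p} ∩ V Λ^{(p ∨ q) - q}`, for `U ⊆ Λ^p` and `V ⊆ Λ^q`. -/
def join (p q : Fin k → ℕ) (U V : Set Λ.Mor) : Set Λ.Mor :=
  Λ.setComp U (Λ.paths ((p ⊔ q) - p)) ∩ Λ.setComp V (Λ.paths ((p ⊔ q) - q))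

/-- `Λ^min(a, b)`, the pairs `(α, β)` with `a α = b β` of degree `d a ∨ d b`. -/
def minExt (a b : Λ.Mor) : Set (Λ.Mor × Λ.Mor) :=
  {p | ∃ (h : Λ.s a = Λ.r p.1) (h' : Λ.s b = Λ.r p.2),
    Λ.comp a p.1 h = Λ.comp b p.2 h' ∧ Λ.d (Λ.comp a p.1 h) = Λ.d a ⊔ Λ.d b}

/-- `Λ` is compactly aligned: `U ∨ V` is compact for all compact `U ⊆ Λ^p` and `V ⊆ Λ^q`. -/
def CompactlyAligned : Prop :=
  ∀ (p q : Fin k → ℕ) (U V : Set Λ.Mor), U ⊆ Λ.paths p → V ⊆ Λ.paths q →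
    IsCompact U → IsCompact V → IsCompact (Λ.join p q U V)

/-- `E` is exhaustive for `V`: `E ⊆ V Λ`, and every `a ∈ V Λ` has a minimal common extension with
some `b ∈ E`. -/
def Exhaustive (E : Set Λ.Mor) (V : Set Λ.Obj) : Prop :=
  (∀ b ∈ E, Λ.r b ∈ V) ∧ ∀ a, Λ.r a ∈ V → ∃ b ∈ E, (Λ.minExt a b).Nonempty

/-- `w CE(Λ)`: the compact sets `E` such that `r(E)` is a neighbourhood of `w` and `E` is exhaustive
for `r(E)`. -/
def CE (w : Λ.Obj) : Set (Set Λ.Mor) :=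
  {E | IsCompact E ∧ Λ.r '' E ∈ 𝓝 w ∧ Λ.Exhaustive E (Λ.r '' E)}

end Graph

/-- `p ≤ m`, for `p ∈ ℕ^k` and `m ∈ (ℕ ∪ {∞})^k`. -/
def Below (p : Fin k → ℕ) (m : Fin k → ℕ∞) : Prop := ∀ i, (p i : ℕ∞) ≤ m i

theorem Below.mono {p q : Fin k → ℕ} {m : Fin k → ℕ∞} (hpq : p ≤ q) (hq : Below q m) :
    Below p m := fun i => (Nat.cast_le.mpr (hpq i)).trans (hq i)

theorem below_zero (m : Fin k → ℕ∞) : Below (0 : Fin k → ℕ) m := fun i => by simp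

theorem Below.sub_iff {p q : Fin k → ℕ} {m : Fin k → ℕ∞} (hp : Below p m) :
    Below q (fun i => m i - p i) ↔ Below (p + q) m := by
  refine forall_congr' fun i => ?_
  have h := hp i
  change (q i : ℕ∞) ≤ m i - (p i : ℕ∞) ↔ (((p i + q i : ℕ)) : ℕ∞) ≤ m i
  generalize m i = x at *
  induction x using ENat.recTopCoe with
  | top => simp
  | coe x =>
    norm_cast at *
    omega

/-- The path prototype `Ω_{k,m}`: the objects are the `p ≤ m` in `ℕ^k`, the morphisms the pairs
`(p, q)` with `p ≤ q ≤ m`, with `r (p, q) = p`, `s (p, q) = q`, `(n, p) (p, q) = (n, q)` and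
`d (p, q) = q - p`. The subspace topologies from `ℕ^k` and `ℕ^k × ℕ^k` are the discrete ones. -/
def Omega (k : ℕ) (m : Fin k → ℕ∞) : TopologicalKGraph.{0, 0} k where
  Obj := {p : Fin k → ℕ // Below p m}
  Mor := {p : (Fin k → ℕ) × (Fin k → ℕ) // p.1 ≤ p.2 ∧ Below p.2 m}
  r a := ⟨a.1.1, a.2.2.mono a.2.1⟩
  s a := ⟨a.1.2, a.2.2⟩
  ident p := ⟨(p.1, p.1), le_rfl, p.2⟩
  comp a b h := ⟨(a.1.1, b.1.2),
    (a.2.1.trans (congrArg Subtype.val h).le).trans b.2.1, b.2.2⟩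
  r_ident _ := rfl
  s_ident _ := rfl
  r_comp _ _ _ := rfl
  s_comp _ _ _ := rfl
  ident_comp _ := rfl
  comp_ident _ := rfl
  assoc _ _ _ _ _ := rfl
  d a := a.1.2 - a.1.1
  d_ident _ := by simp
  d_comp a b h := by
    obtain ⟨⟨a₁, a₂⟩, ha, ha'⟩ := a
    obtain ⟨⟨b₁, b₂⟩, hb, hb'⟩ := b
    have h : a₂ = b₁ := congrArg Subtype.val h
    subst h
    funext i
    have h1 := ha i
    have h2 := hb i
    simp only [Pi.sub_apply, Pi.add_apply] at *
    omega
  continuous_r := continuous_of_discreteTopology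
  continuous_s := continuous_of_discreteTopology
  isLocalHomeomorph_s := by
    rw [isLocalHomeomorph_iff_isOpenEmbedding_restrict]
    intro a
    refine ⟨{a}, (isOpen_discrete _).mem_nhds rfl, ?_⟩
    refine .of_continuous_injective_isOpenMap continuous_of_discreteTopology ?_
      fun _ _ => isOpen_discrete _
    rintro ⟨x, rfl⟩ ⟨y, rfl⟩ _
    rfl
  continuous_comp := continuous_of_discreteTopology
  isOpenMap_comp := fun _ _ => isOpen_discrete _
  continuous_d := continuous_of_discreteTopology
  factorisation := by
    rintro ⟨⟨a, b⟩, hab, hb⟩ p q h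
    have h : b - a = p + q := h
    have hi : ∀ i, a i ≤ b i ∧ b i - a i = p i + q i := fun i => ⟨hab i, congrFun h i⟩
    have hc : a + p ≤ b := fun i => by have := hi i; simp only [Pi.add_apply]; omega
    refine ⟨(⟨(a, a + p), fun i => by simp, hb.mono hc⟩, ⟨(a + p, b), hc, hb⟩),
      ⟨rfl, rfl, ?_, ?_⟩, ?_⟩
    · funext i; simp
    · funext i
      have := hi i
      simp only [Pi.sub_apply, Pi.add_apply]
      omega
    · rintro ⟨⟨⟨x, y⟩, hxy, hy⟩, ⟨⟨z, w⟩, hzw, hw⟩⟩ ⟨h1, h2, h3, h4⟩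
      have h1 : y = z := congrArg Subtype.val h1
      have h2 : (x, w) = (a, b) := congrArg Subtype.val h2
      obtain ⟨rfl, rfl⟩ := Prod.mk.inj h2
      subst h1
      have h3 : y - x = p := h3
      have : y = x + p := by
        subst h3
        funext i
        have := hxy i
        simp only [Pi.sub_apply, Pi.add_apply] at *
        omega
      subst this
      rfl

/-- A graph morphism: a continuous degree-preserving functor. -/
@[ext]
structure GraphMorphism (Λ₁ : TopologicalKGraph.{u₁, v₁} k) (Λ₂ : TopologicalKGraph.{u, v} k) where
  /-- the map on objects -/
  obj : Λ₁.Obj → Λ₂.Obj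
  /-- the map on morphisms -/
  mor : Λ₁.Mor → Λ₂.Mor
  continuous_obj : Continuous obj
  continuous_mor : Continuous mor
  map_r : ∀ a, Λ₂.r (mor a) = obj (Λ₁.r a)
  map_s : ∀ a, Λ₂.s (mor a) = obj (Λ₁.s a)
  map_ident : ∀ x, mor (Λ₁.ident x) = Λ₂.ident (obj x)
  map_comp : ∀ a b (h : Λ₁.s a = Λ₁.r b), mor (Λ₁.comp a b h)
    = Λ₂.comp (mor a) (mor b) ((map_s a).trans ((congrArg obj h).trans (map_r b).symm))
  map_d : ∀ a, Λ₂.d (mor a) = Λ₁.d a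

/-- The path space `X_Λ`: the disjoint union over `m ∈ (ℕ ∪ {∞})^k` of the sets of graph morphisms
`Ω_{k,m} → Λ`. -/
structure PathSpace (Λ : TopologicalKGraph.{u, v} k) where
  /-- the degree `d(x)` -/
  degree : Fin k → ℕ∞
  /-- the graph morphism `Ω_{k,d(x)} → Λ` -/
  toMorphism : GraphMorphism (Omega k degree) Λ

section Paths

variable {Λ : TopologicalKGraph.{u, v} k}

namespace PathSpace

/-- The vertex `x(p)`. -/
def vertex (x : Λ.PathSpace) (p : Fin k → ℕ) (hp : Below p x.degree) : Λ.Obj :=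
  x.toMorphism.obj ⟨p, hp⟩

/-- The segment `x(p, q)`. -/
def seg (x : Λ.PathSpace) (p q : Fin k → ℕ) (hpq : p ≤ q) (hq : Below q x.degree) : Λ.Mor :=
  x.toMorphism.mor ⟨(p, q), hpq, hq⟩

/-- The range `r(x) = x(0)`. -/
def range (x : Λ.PathSpace) : Λ.Obj := x.vertex 0 (below_zero _)

/-- The shift `σ^p x`, of degree `d(x) - p`, with `(σ^p x)(a, b) = x(p + a, p + b)`. -/
def shift (x : Λ.PathSpace) (p : Fin k → ℕ) (hp : Below p x.degree) : Λ.PathSpace where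
  degree i := x.degree i - p i
  toMorphism :=
    { obj := fun a => x.vertex (p + a.1) (hp.sub_iff.mp a.2)
      mor := fun a => x.seg (p + a.1.1) (p + a.1.2) (add_le_add_right a.2.1 p)
        (hp.sub_iff.mp a.2.2)
      continuous_obj := continuous_of_discreteTopology (α := {q : Fin k → ℕ // Below q _})
      continuous_mor := continuous_of_discreteTopology
        (α := {q : (Fin k → ℕ) × (Fin k → ℕ) // q.1 ≤ q.2 ∧ Below q.2 _})
      map_r := fun _ => x.toMorphism.map_r _
      map_s := fun _ => x.toMorphism.map_s _
      map_ident := fun a => x.toMorphism.map_ident ⟨p + a.1, hp.sub_iff.mp a.2⟩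
      map_comp := fun a b h => by
        obtain ⟨⟨a₁, a₂⟩, ha, ha'⟩ := a
        obtain ⟨⟨b₁, b₂⟩, hb, hb'⟩ := b
        have h : a₂ = b₁ := congrArg Subtype.val h
        subst h
        exact x.toMorphism.map_comp
          ⟨(p + a₁, p + a₂), add_le_add_right ha p, hp.sub_iff.mp ha'⟩
          ⟨(p + a₂, p + b₂), add_le_add_right hb p, hp.sub_iff.mp hb'⟩ rfl
      map_d := fun a => by
        refine (x.toMorphism.map_d _).trans ?_
        change (p + a.1.2) - (p + a.1.1) = a.1.2 - a.1.1
        funext i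
        exact Nat.add_sub_add_left _ _ _ }

theorem ext_seg {x y : Λ.PathSpace} (hd : x.degree = y.degree)
    (h : ∀ p q hpq hq hq', x.seg p q hpq hq = y.seg p q hpq hq') : x = y := by
  obtain ⟨m, f⟩ := x
  obtain ⟨n, g⟩ := y
  obtain rfl : m = n := hd
  have hmor : f.mor = g.mor := by
    funext a
    exact h a.1.1 a.1.2 a.2.1 a.2.2 a.2.2
  congr
  refine GraphMorphism.ext ?_ hmor
  funext a
  have h1 := f.map_r ((Omega k m).ident a)
  have h2 := g.map_r ((Omega k m).ident a)
  rw [(Omega k m).r_ident] at h1 h2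
  rw [← h1, ← h2, hmor]

theorem shift_shift (x : Λ.PathSpace) (p q : Fin k → ℕ) (hp : Below p x.degree)
    (hq : Below q (x.shift p hp).degree) :
    (x.shift p hp).shift q hq = x.shift (p + q) (hp.sub_iff.mp hq) := by
  refine ext_seg ?_ ?_
  · funext i
    simp [shift, tsub_tsub]
  · intro a b hab hb hb'
    unfold seg
    refine congrArg x.toMorphism.mor (Subtype.ext (Prod.ext ?_ ?_))
    · exact (add_assoc p q a).symm
    · exact (add_assoc p q b).symm

theorem shift_congr {x y : Λ.PathSpace} (hxy : x = y) {p q : Fin k → ℕ} (hpq : p = q)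
    (hp : Below p x.degree) (hq : Below q y.degree) : x.shift p hp = y.shift q hq := by
  subst hxy hpq
  rfl

end PathSpace

/-- `(x, n, y) ∈ G_Λ`: there are `p ≤ d(x)` and `q ≤ d(y)` with `p - q = n` and
`σ^p x = σ^q y`. -/
def Lag (x : Λ.PathSpace) (n : Fin k → ℤ) (y : Λ.PathSpace) : Prop :=
  ∃ (p q : Fin k → ℕ) (hp : Below p x.degree) (hq : Below q y.degree),
    (fun i => (p i : ℤ) - (q i : ℤ)) = n ∧ x.shift p hp = y.shift q hq

theorem Lag.refl (x : Λ.PathSpace) : Lag x 0 x :=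
  ⟨0, 0, below_zero _, below_zero _, by funext i; simp, rfl⟩

theorem Lag.symm {x y : Λ.PathSpace} {n : Fin k → ℤ} (h : Lag x n y) : Lag y (-n) x := by
  obtain ⟨p, q, hp, hq, rfl, e⟩ := h
  exact ⟨q, p, hq, hp, by funext i; simp, e.symm⟩

theorem Lag.trans {x y z : Λ.PathSpace} {m n : Fin k → ℤ} (h : Lag x m y) (h' : Lag y n z) :
    Lag x (m + n) z := by
  obtain ⟨p, q, hp, hq, rfl, e⟩ := h
  obtain ⟨p', q', hp', hq', rfl, e'⟩ := h'
  have h1 : q + (q ⊔ p' - q) = q ⊔ p' := add_tsub_cancel_of_le le_sup_left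
  have h2 : p' + (q ⊔ p' - p') = q ⊔ p' := add_tsub_cancel_of_le le_sup_right
  have ht : Below (q ⊔ p') y.degree := fun i => by
    rcases le_total (q i) (p' i) with hi | hi
    · simpa [hi] using hp' i
    · simpa [hi] using hq i
  have b1 : Below (q ⊔ p' - q) (y.shift q hq).degree := hq.sub_iff.mpr (by rwa [h1])
  have b2 : Below (q ⊔ p' - p') (y.shift p' hp').degree := hp'.sub_iff.mpr (by rwa [h2])
  have b1' : Below (q ⊔ p' - q) (x.shift p hp).degree := by rw [e]; exact b1
  have b2' : Below (q ⊔ p' - p') (z.shift q' hq').degree := by rw [← e']; exact b2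
  refine ⟨p + (q ⊔ p' - q), q' + (q ⊔ p' - p'), hp.sub_iff.mp b1', hq'.sub_iff.mp b2', ?_, ?_⟩
  · funext i
    have i1 := congrFun h1 i
    have i2 := congrFun h2 i
    simp only [Pi.add_apply] at i1 i2 ⊢
    push_cast
    omega
  · rw [← PathSpace.shift_shift x p _ hp b1', ← PathSpace.shift_shift z q' _ hq' b2',
      PathSpace.shift_congr e rfl b1' b1, ← PathSpace.shift_congr e' rfl b2 b2',
      PathSpace.shift_shift, PathSpace.shift_shift]
    exact PathSpace.shift_congr rfl (h1.trans h2.symm) _ _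

/-- The path groupoid `G_Λ`, with object set `X_Λ`. The element `(x, n, y)`, with range `x` and source
`y`, is the arrow `n : y ⟶ x`; products are `(x, m, y) (y, n, z) = (x, m + n, z)` and inverses
`(x, n, y)⁻¹ = (y, -n, x)`. -/
instance pathGroupoid : CategoryTheory.Groupoid.{0} Λ.PathSpace where
  Hom y x := {n : Fin k → ℤ // Lag x n y}
  id x := ⟨0, Lag.refl x⟩
  comp g f := ⟨f.1 + g.1, f.2.trans g.2⟩
  inv f := ⟨-f.1, f.2.symm⟩
  id_comp f := Subtype.ext (add_zero f.1)
  comp_id f := Subtype.ext (zero_add f.1)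
  assoc f g h := Subtype.ext (add_assoc h.1 g.1 f.1).symm
  inv_comp f := Subtype.ext (add_neg_cancel f.1)
  comp_inv f := Subtype.ext (neg_add_cancel f.1)

end Paths

end TopologicalKGraph

/-- An element of a groupoid `C`: an arrow together with its range and its source. -/
structure GroupoidElement (C : Type u) [CategoryTheory.Groupoid.{v} C] where
  /-- the range -/
  range : C
  /-- the source -/
  source : C
  /-- the arrow -/
  arrow : source ⟶ range

namespace GroupoidElement

variable (C : Type u) [CategoryTheory.Groupoid.{v} C]

/-- The unit at an object. -/
def unit {C : Type u} [CategoryTheory.Groupoid.{v} C] (x : C) : GroupoidElement C :=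
  ⟨x, x, CategoryTheory.CategoryStruct.id x⟩

/-- The unit space `Γ⁽⁰⁾`. -/
def units : Set (GroupoidElement C) := Set.range unit

/-- A groupoid with a topology on its set of elements is essentially free: the units `x` with
`x Γ x = {x}` are dense in the unit space (with the relative topology). -/
def EssentiallyFree [TopologicalSpace (GroupoidElement C)] : Prop :=
  Dense {x : units C | {γ : GroupoidElement C | γ.range = x.1.range ∧ γ.source = x.1.range} = {x.1}}

end GroupoidElement

namespace TopologicalKGraph

variable {k : ℕ} {Λ : TopologicalKGraph.{u, v} k}

/-- `y = a x`, the concatenation of a finite path `a` with a path `x`: the initial segment of `y` of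
degree `d(a)` is `a`, and what remains is `x`. -/
def IsConcat (a : Λ.Mor) (x y : Λ.PathSpace) : Prop :=
  ∃ h : Below (Λ.d a) y.degree,
    y.seg 0 (Λ.d a) (fun _ => Nat.zero_le _) h = a ∧ y.shift (Λ.d a) h = x

/-- `Z(F, m)`, the set of all `(a x, d(a) - d(b), b x)` with `(a, b) ∈ F` and
`d(a) - d(b) = m`. -/
def cylinder (F : Set (Λ.Mor × Λ.Mor)) (m : Fin k → ℤ) : Set (GroupoidElement Λ.PathSpace) :=
  {γ | γ.arrow.1 = m ∧ ∃ a b, (a, b) ∈ F ∧ (fun i => (Λ.d a i : ℤ) - (Λ.d b i : ℤ)) = m ∧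
    ∃ x : Λ.PathSpace, IsConcat a x γ.range ∧ IsConcat b x γ.source}

/-- The topology on the path groupoid `G_Λ` generated by the sets `Z(U *_s V, m) ∩ Z(F, m)ᶜ` with `U`,
`V` open in `Λ` and `F ⊆ Λ *_s Λ` compact. -/
instance pathGroupoidTopology : TopologicalSpace (GroupoidElement Λ.PathSpace) :=
  TopologicalSpace.generateFrom
    {S | ∃ (m : Fin k → ℤ) (U V : Set Λ.Mor) (F : Set (Λ.Mor × Λ.Mor)),
      IsOpen U ∧ IsOpen V ∧ F ⊆ Λ.sourcePairs ∧ IsCompact F ∧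
        S = cylinder (Λ.starS U V) m ∩ (cylinder F m)ᶜ}

/-- `x` is a boundary path: for all `m ≤ d(x)` and `E ∈ x(m) CE(Λ)` there is `a ∈ E` with
`x(m, m + d(a)) = a`. -/
def IsBoundaryPath (x : Λ.PathSpace) : Prop :=
  ∀ (m : Fin k → ℕ) (hm : Below m x.degree), ∀ E ∈ Λ.CE (x.vertex m hm),
    ∃ a ∈ E, ∃ h : Below (m + Λ.d a) x.degree,
      x.seg m (m + Λ.d a) (fun _ => Nat.le_add_right _ _) h = a

variable (Λ) in
/-- The set `∂Λ` of boundary paths. -/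
def BoundaryPath : Type (max u v) := {x : Λ.PathSpace // IsBoundaryPath x}

/-- The boundary-path groupoid, the reduction `G_Λ|_{∂Λ}`: its elements are the elements of `G_Λ` with
range and source in `∂Λ`. -/
instance boundaryPathGroupoid : CategoryTheory.Groupoid.{0} Λ.BoundaryPath where
  Hom y x := (y.1 : Λ.PathSpace) ⟶ x.1
  id x := CategoryTheory.CategoryStruct.id x.1
  comp f g := CategoryTheory.CategoryStruct.comp f g
  inv f := CategoryTheory.Groupoid.inv f
  id_comp f := CategoryTheory.Category.id_comp (obj := Λ.PathSpace) f
  comp_id f := CategoryTheory.Category.comp_id (obj := Λ.PathSpace) f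
  assoc f g h := CategoryTheory.Category.assoc (obj := Λ.PathSpace) f g h
  inv_comp f := CategoryTheory.Groupoid.inv_comp (obj := Λ.PathSpace) f
  comp_inv f := CategoryTheory.Groupoid.comp_inv (obj := Λ.PathSpace) f

/-- The inclusion of the boundary-path groupoid into the path groupoid. -/
def boundaryInclusion (γ : GroupoidElement Λ.BoundaryPath) : GroupoidElement Λ.PathSpace :=
  ⟨γ.range.1, γ.source.1, γ.arrow⟩

/-- The boundary-path groupoid has the relative topology of the path groupoid. -/
instance boundaryPathGroupoidTopology : TopologicalSpace (GroupoidElement Λ.BoundaryPath) :=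
  TopologicalSpace.induced boundaryInclusion pathGroupoidTopology

/-- `x` is aperiodic: for `p, q ≤ d(x)`, `p ≠ q` implies `σ^p x ≠ σ^q x`. -/
def Aperiodic (x : Λ.PathSpace) : Prop :=
  ∀ (p q : Fin k → ℕ) (hp : Below p x.degree) (hq : Below q x.degree),
    p ≠ q → x.shift p hp ≠ x.shift q hq

variable (Λ) in
/-- Condition (A): for every nonempty open `V ⊆ Λ⁰` there is an aperiodic boundary path with range
in `V`. -/
def ConditionA : Prop :=
  ∀ V : Set Λ.Obj, IsOpen V → V.Nonempty →
    ∃ x : Λ.PathSpace, IsBoundaryPath x ∧ x.range ∈ V ∧ Aperiodic x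

end TopologicalKGraph

/-! An isotropy element at a boundary path `x` is a triple (x, p - q, x) with σ^p x = σ^q x, so the
isotropy at `x` is trivial exactly when `x` is aperiodic (`aperiodic_iff`). Essential freeness
therefore says that aperiodic boundary paths are dense in ∂Λ, and condition (A) has to be compared
with this density. Throughout, a path is handled through its set of finite initial segments, which
determines it (`PathSpace.ext_prefixes`).

Density gives (A) because the boundary paths with range in an open V form an open set, which is
nonempty when V is: every vertex is the range of a boundary path (`exists_isBoundaryPath`, by Zorn's
lemma and a limit argument resting on compact alignment).

Conversely, a neighbourhood of the boundary path `x` contains all paths that have an initial segment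
in some neighbourhood W of a segment `a` of `x` and none in a compact set K that `x` avoids
(`exists_nhds_of_unit_mem`). If every finite path extending a member of W had a common extension
with a member of K, the boundary condition would force `x` into K
(`IsBoundaryAt.exists_mem_prefixes`). So some `e` extending a member of W is incompatible with all
of K, and by compact alignment so are all `e'` near `e` (`eventually_forall_not_prefix`). Their
sources form an open set, where (A) provides an aperiodic boundary path z. Then e'z lies in the
given neighbourhood, and it inherits both properties from its shift z (`isBoundaryPath_of_shift`,
`aperiodic_of_shift`). -/

namespace TopologicalKGraph

variable {k : ℕ}

/-! ### Initial segments of finite paths, truncation and its continuity -/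

section Prefixes

variable (Λ : TopologicalKGraph.{u, v} k)

/-- `a` is an initial segment of `e`. -/
def Prefix (a e : Λ.Mor) : Prop := ∃ b, ∃ h : Λ.s a = Λ.r b, Λ.comp a b h = e

variable {Λ}

theorem comp_congr {a a' b b' : Λ.Mor} (ha : a = a') (hb : b = b') (h : Λ.s a = Λ.r b)
    (h' : Λ.s a' = Λ.r b') : Λ.comp a b h = Λ.comp a' b' h' := by
  subst ha hb
  rfl

theorem comp_left_cancel {a b b' : Λ.Mor} {h : Λ.s a = Λ.r b} {h' : Λ.s a = Λ.r b'}
    (e : Λ.comp a b h = Λ.comp a b' h') : b = b' := by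
  have hd : Λ.d b' = Λ.d b := by
    have := congrArg Λ.d e
    rw [Λ.d_comp, Λ.d_comp] at this
    exact (add_left_cancel this).symm
  exact congrArg Prod.snd ((Λ.factorisation _ _ _ (Λ.d_comp a b h)).unique
    (y₁ := (a, b)) (y₂ := (a, b')) ⟨h, rfl, rfl, rfl⟩ ⟨h', e.symm, rfl, hd⟩)

theorem comp_left_unique {a a' b b' : Λ.Mor} {h : Λ.s a = Λ.r b} {h' : Λ.s a' = Λ.r b'}
    (hd : Λ.d a = Λ.d a') (e : Λ.comp a b h = Λ.comp a' b' h') : a = a' := by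
  have hd' : Λ.d b' = Λ.d b := by
    have := congrArg Λ.d e
    rw [Λ.d_comp, Λ.d_comp, hd] at this
    exact (add_left_cancel this).symm
  exact congrArg Prod.fst ((Λ.factorisation _ _ _ (Λ.d_comp a b h)).unique
    (y₁ := (a, b)) (y₂ := (a', b')) ⟨h, rfl, rfl, rfl⟩ ⟨h', e.symm, hd.symm, hd'⟩)

namespace Prefix

theorem of_comp (a b : Λ.Mor) (h : Λ.s a = Λ.r b) : Λ.Prefix a (Λ.comp a b h) := ⟨b, h, rfl⟩

theorem refl (a : Λ.Mor) : Λ.Prefix a a := ⟨_, _, Λ.comp_ident a⟩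

theorem trans {a b c : Λ.Mor} (hab : Λ.Prefix a b) (hbc : Λ.Prefix b c) : Λ.Prefix a c := by
  obtain ⟨x, hx, rfl⟩ := hab
  obtain ⟨y, hy, rfl⟩ := hbc
  exact ⟨Λ.comp x y ((Λ.s_comp _ _ _).symm.trans hy), _,
    (Λ.assoc a x y hx ((Λ.s_comp _ _ _).symm.trans hy)).symm⟩

theorem d_le {a e : Λ.Mor} (h : Λ.Prefix a e) : Λ.d a ≤ Λ.d e := by
  obtain ⟨b, h, rfl⟩ := h
  rw [Λ.d_comp]
  exact fun i => Nat.le_add_right _ _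

theorem range_eq {a e : Λ.Mor} (h : Λ.Prefix a e) : Λ.r e = Λ.r a := by
  obtain ⟨b, h, rfl⟩ := h
  exact Λ.r_comp _ _ _

theorem exists_of_le {n : Fin k → ℕ} {e : Λ.Mor} (hn : n ≤ Λ.d e) :
    ∃ a, Λ.Prefix a e ∧ Λ.d a = n := by
  obtain ⟨⟨a, b⟩, ⟨h, h1, h2, -⟩, -⟩ :=
    Λ.factorisation e n (Λ.d e - n) (add_tsub_cancel_of_le hn).symm
  exact ⟨a, ⟨b, h, h1⟩, h2⟩

theorem unique {a b e : Λ.Mor} (ha : Λ.Prefix a e) (hb : Λ.Prefix b e) (hd : Λ.d a = Λ.d b) :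
    a = b := by
  obtain ⟨x, hx, rfl⟩ := ha
  obtain ⟨y, hy, e⟩ := hb
  exact comp_left_unique hd e.symm

theorem of_le {a b e : Λ.Mor} (ha : Λ.Prefix a e) (hb : Λ.Prefix b e) (hd : Λ.d a ≤ Λ.d b) :
    Λ.Prefix a b := by
  obtain ⟨a', h, h'⟩ := exists_of_le hd
  rwa [ha.unique (h.trans hb) h'.symm]

theorem comp_left {a b c : Λ.Mor} (hbc : Λ.Prefix b c) (hb : Λ.s a = Λ.r b)
    (hc : Λ.s a = Λ.r c) : Λ.Prefix (Λ.comp a b hb) (Λ.comp a c hc) := by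
  obtain ⟨x, hx, rfl⟩ := hbc
  exact ⟨x, (Λ.s_comp _ _ _).trans hx, Λ.assoc _ _ _ _ _⟩

theorem of_comp_left {a b c : Λ.Mor} {hb : Λ.s a = Λ.r b} {hc : Λ.s a = Λ.r c}
    (h : Λ.Prefix (Λ.comp a b hb) (Λ.comp a c hc)) : Λ.Prefix b c := by
  obtain ⟨x, hx, e⟩ := h
  have hx' : Λ.s b = Λ.r x := (Λ.s_comp _ _ _).symm.trans hx
  rw [Λ.assoc a b x hb hx'] at e
  exact ⟨x, hx', comp_left_cancel e⟩

end Prefix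

/-- Any common extension can be cut down to degree d(a) ∨ d(b), so minimality costs nothing. -/
theorem minExt_nonempty_iff {a b : Λ.Mor} :
    (Λ.minExt a b).Nonempty ↔ ∃ e, Λ.Prefix a e ∧ Λ.Prefix b e := by
  constructor
  · rintro ⟨⟨x, y⟩, h, h', e, -⟩
    exact ⟨_, ⟨x, h, rfl⟩, ⟨y, h', e.symm⟩⟩
  · rintro ⟨e, ha, hb⟩
    obtain ⟨f, hf, hd⟩ := Prefix.exists_of_le (sup_le ha.d_le hb.d_le)
    obtain ⟨x, hx, rfl⟩ := ha.of_le hf (hd ▸ le_sup_left)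
    obtain ⟨y, hy, e⟩ := hb.of_le hf (hd ▸ le_sup_right)
    exact ⟨(x, y), hx, hy, e.symm, hd⟩

/-- Puts compact alignment into the language of initial segments, the form in which it is used
below. -/
theorem mem_join_iff {p q : Fin k → ℕ} {U V : Set Λ.Mor} (hU : U ⊆ Λ.paths p)
    (hV : V ⊆ Λ.paths q) {e : Λ.Mor} :
    e ∈ Λ.join p q U V ↔
      Λ.d e = p ⊔ q ∧ (∃ a ∈ U, Λ.Prefix a e) ∧ ∃ b ∈ V, Λ.Prefix b e := by
  have key : ∀ {p m : Fin k → ℕ} {U : Set Λ.Mor}, U ⊆ Λ.paths p → p ≤ m →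
      (e ∈ Λ.setComp U (Λ.paths (m - p)) ↔ Λ.d e = m ∧ ∃ a ∈ U, Λ.Prefix a e) := by
    intro p m U hU hpm
    constructor
    · rintro ⟨a, ha, b, hb, h, rfl⟩
      refine ⟨?_, a, ha, .of_comp _ _ _⟩
      rw [Λ.d_comp, show Λ.d a = p from hU ha, show Λ.d b = m - p from hb]
      exact add_tsub_cancel_of_le hpm
    · rintro ⟨hd, a, ha, b, h, rfl⟩
      refine ⟨a, ha, b, ?_, h, rfl⟩
      rw [Λ.d_comp, show Λ.d a = p from hU ha] at hd
      exact (tsub_eq_of_eq_add_rev hd.symm).symm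
  rw [join, Set.mem_inter_iff, key hU le_sup_left, key hV le_sup_right]
  tauto

variable (Λ)

open Classical in
/-- The initial segment of degree `n` of `c`. -/
noncomputable def pre (n : Fin k → ℕ) (c : Λ.Mor) : Λ.Mor :=
  if h : n ≤ Λ.d c then (Prefix.exists_of_le h).choose else c

open Classical in
/-- What remains of `c` when the initial segment of degree `n` is removed. -/
noncomputable def suf (n : Fin k → ℕ) (c : Λ.Mor) : Λ.Mor :=
  if h : n ≤ Λ.d c then (Prefix.exists_of_le h).choose_spec.1.choose else c

variable {Λ}

theorem pre_prefix {n : Fin k → ℕ} {c : Λ.Mor} (h : n ≤ Λ.d c) : Λ.Prefix (Λ.pre n c) c := by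
  rw [pre, dif_pos h]
  exact (Prefix.exists_of_le h).choose_spec.1

theorem d_pre {n : Fin k → ℕ} {c : Λ.Mor} (h : n ≤ Λ.d c) : Λ.d (Λ.pre n c) = n := by
  rw [pre, dif_pos h]
  exact (Prefix.exists_of_le h).choose_spec.2

theorem pre_suf {n : Fin k → ℕ} {c : Λ.Mor} (h : n ≤ Λ.d c) :
    ∃ h : Λ.s (Λ.pre n c) = Λ.r (Λ.suf n c), Λ.comp (Λ.pre n c) (Λ.suf n c) h = c := by
  rw [pre, suf, dif_pos h, dif_pos h]
  exact (Prefix.exists_of_le h).choose_spec.1.choose_spec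

theorem Prefix.pre_eq {a c : Λ.Mor} (h : Λ.Prefix a c) : Λ.pre (Λ.d a) c = a :=
  (pre_prefix h.d_le).unique h (d_pre h.d_le)

theorem pre_comp {a b : Λ.Mor} (h : Λ.s a = Λ.r b) : Λ.pre (Λ.d a) (Λ.comp a b h) = a :=
  (Prefix.of_comp a b h).pre_eq

theorem suf_comp {a b : Λ.Mor} (h : Λ.s a = Λ.r b) : Λ.suf (Λ.d a) (Λ.comp a b h) = b := by
  obtain ⟨h', e⟩ := pre_suf (Prefix.of_comp a b h).d_le
  refine comp_left_cancel (a := a) (h := ?_) (h' := h) ?_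
  · rwa [pre_comp] at h'
  · exact (comp_congr (pre_comp h).symm rfl _ h').trans e

theorem Prefix.comp_suf {a c : Λ.Mor} (h : Λ.Prefix a c) :
    ∃ h' : Λ.s a = Λ.r (Λ.suf (Λ.d a) c), Λ.comp a (Λ.suf (Λ.d a) c) h' = c := by
  obtain ⟨b, hb, rfl⟩ := h
  rw [suf_comp]
  exact ⟨hb, rfl⟩

theorem isOpen_paths (n : Fin k → ℕ) : IsOpen (Λ.paths n) :=
  (isOpen_discrete {n}).preimage Λ.continuous_d

theorem isClosed_paths (n : Fin k → ℕ) : IsClosed (Λ.paths n) :=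
  (isClosed_discrete {n}).preimage Λ.continuous_d

theorem isOpen_setComp {U V : Set Λ.Mor} (hU : IsOpen U) (hV : IsOpen V) :
    IsOpen (Λ.setComp U V) := by
  convert Λ.isOpenMap_comp _ ((hU.prod hV).preimage continuous_subtype_val)
  ext c
  constructor
  · rintro ⟨a, ha, b, hb, h, rfl⟩
    exact ⟨⟨(a, b), h⟩, ⟨ha, hb⟩, rfl⟩
  · rintro ⟨⟨⟨a, b⟩, h⟩, ⟨ha, hb⟩, rfl⟩
    exact ⟨a, ha, b, hb, h, rfl⟩

theorem isCompact_setComp {U V : Set Λ.Mor} (hU : IsCompact U) (hV : IsCompact V) :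
    IsCompact (Λ.setComp U V) := by
  have hcl : IsClosed {p : Λ.Mor × Λ.Mor | Λ.s p.1 = Λ.r p.2} :=
    isClosed_eq (Λ.continuous_s.comp continuous_fst) (Λ.continuous_r.comp continuous_snd)
  convert (hcl.isClosedEmbedding_subtypeVal.isCompact_preimage (hU.prod hV)).image
    Λ.continuous_comp
  ext c
  constructor
  · rintro ⟨a, ha, b, hb, h, rfl⟩
    exact ⟨⟨(a, b), h⟩, ⟨ha, hb⟩, rfl⟩
  · rintro ⟨⟨⟨a, b⟩, h⟩, ⟨ha, hb⟩, rfl⟩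
    exact ⟨a, ha, b, hb, h, rfl⟩

/-- Since composition is open, the composites with first factor in an open subset of Λ^n form an
open set; on it, unique factorisation makes that factor the value of `pre`. -/
theorem continuousAt_pre {n : Fin k → ℕ} {c : Λ.Mor} (h : n ≤ Λ.d c) :
    ContinuousAt (Λ.pre n) c := by
  intro W hW
  obtain ⟨O, hOW, hO, hcO⟩ := mem_nhds_iff.mp hW
  obtain ⟨h', e⟩ := pre_suf h
  have : Λ.setComp (O ∩ Λ.paths n) Set.univ ∈ 𝓝 c :=
    (isOpen_setComp (hO.inter (isOpen_paths n)) isOpen_univ).mem_nhds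
      ⟨_, ⟨hcO, d_pre h⟩, _, trivial, h', e⟩
  rw [Filter.mem_map]
  filter_upwards [this]
  rintro _ ⟨a, ⟨ha, rfl⟩, b, -, hab, rfl⟩
  rw [Set.mem_preimage, pre_comp]
  exact hOW ha

theorem Prefix.eventually_pre {a c : Λ.Mor} (h : Λ.Prefix a c) {W : Set Λ.Mor} (hW : W ∈ 𝓝 a) :
    ∀ᶠ e in 𝓝 c, Λ.Prefix (Λ.pre (Λ.d a) e) e ∧ Λ.pre (Λ.d a) e ∈ W := by
  have h1 : ∀ᶠ e in 𝓝 c, Λ.d a ≤ Λ.d e :=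
    ((isOpen_discrete {n | Λ.d a ≤ n}).preimage Λ.continuous_d).mem_nhds h.d_le
  rw [← h.pre_eq] at hW
  filter_upwards [h1, (continuousAt_pre h.d_le).preimage_mem_nhds hW] with e he he'
  exact ⟨pre_prefix he, he'⟩

theorem continuousAt_suf {n : Fin k → ℕ} {c : Λ.Mor} (h : n ≤ Λ.d c) :
    ContinuousAt (Λ.suf n) c := by
  intro W hW
  obtain ⟨O, hOW, hO, hcO⟩ := mem_nhds_iff.mp hW
  obtain ⟨h', e⟩ := pre_suf h
  have : Λ.setComp (Λ.paths n) O ∈ 𝓝 c :=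
    (isOpen_setComp (isOpen_paths n) hO).mem_nhds ⟨_, d_pre h, _, hcO, h', e⟩
  rw [Filter.mem_map]
  filter_upwards [this]
  rintro _ ⟨a, rfl, b, hb, hab, rfl⟩
  rw [Set.mem_preimage, suf_comp]
  exact hOW hb

theorem finite_degrees {K : Set Λ.Mor} (hK : IsCompact K) : (Λ.d '' K).Finite :=
  (hK.image Λ.continuous_d).finite_of_discrete

end Prefixes

/-! ### Paths described by their finite initial segments -/

section PathPrefixes

theorem degree_nonneg (n : Fin k → ℕ) : 0 ≤ n := fun _ => Nat.zero_le _

theorem degree_le_add (m n : Fin k → ℕ) : m ≤ m + n := fun _ => Nat.le_add_right _ _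

variable {Λ : TopologicalKGraph.{u, v} k}

/-- The finite initial segments of a path. -/
def PathSpace.prefixes (x : Λ.PathSpace) : Set Λ.Mor :=
  {a | ∃ h : Below (Λ.d a) x.degree, x.seg 0 (Λ.d a) (degree_nonneg _) h = a}

namespace PathSpace

variable (x : Λ.PathSpace)

theorem d_seg {p q : Fin k → ℕ} (hpq : p ≤ q) (hq : Below q x.degree) :
    Λ.d (x.seg p q hpq hq) = q - p := x.toMorphism.map_d _

theorem r_seg {p q : Fin k → ℕ} (hpq : p ≤ q) (hq : Below q x.degree) :
    Λ.r (x.seg p q hpq hq) = x.vertex p (hq.mono hpq) := x.toMorphism.map_r _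

theorem s_seg {p q : Fin k → ℕ} (hpq : p ≤ q) (hq : Below q x.degree) :
    Λ.s (x.seg p q hpq hq) = x.vertex q hq := x.toMorphism.map_s _

theorem seg_comp_seg {p q t : Fin k → ℕ} (hpq : p ≤ q) (hqt : q ≤ t) (ht : Below t x.degree) :
    Λ.comp (x.seg p q hpq (ht.mono hqt)) (x.seg q t hqt ht)
      ((x.s_seg _ _).trans (x.r_seg _ _).symm) = x.seg p t (hpq.trans hqt) ht :=
  (x.toMorphism.map_comp ⟨(p, q), hpq, ht.mono hqt⟩ ⟨(q, t), hqt, ht⟩ rfl).symm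

theorem seg_congr {p p' q q' : Fin k → ℕ} (hp : p = p') (hq : q = q') (hpq : p ≤ q)
    (hpq' : p' ≤ q') (h : Below q x.degree) (h' : Below q' x.degree) :
    x.seg p q hpq h = x.seg p' q' hpq' h' := by
  subst hp hq
  rfl

theorem d_seg_zero {n : Fin k → ℕ} (hn : Below n x.degree) :
    Λ.d (x.seg 0 n (degree_nonneg _) hn) = n := by
  rw [d_seg, tsub_zero]

theorem seg_mem_prefixes {n : Fin k → ℕ} (hn : Below n x.degree) :
    x.seg 0 n (degree_nonneg _) hn ∈ x.prefixes := by
  have h := x.d_seg_zero hn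
  exact ⟨h.symm ▸ hn, x.seg_congr rfl h _ _ _ _⟩

variable {x}

theorem eq_seg_of_mem {a : Λ.Mor} (ha : a ∈ x.prefixes) {n : Fin k → ℕ} (hd : Λ.d a = n)
    (hn : Below n x.degree) : a = x.seg 0 n (degree_nonneg _) hn := by
  subst hd
  exact ha.2.symm

theorem prefix_of_mem {a b : Λ.Mor} (ha : a ∈ x.prefixes) (hb : b ∈ x.prefixes)
    (h : Λ.d a ≤ Λ.d b) : Λ.Prefix a b := by
  obtain ⟨ha', ea⟩ := ha
  obtain ⟨hb', eb⟩ := hb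
  rw [← ea, ← eb]
  exact ⟨_, _, x.seg_comp_seg _ h hb'⟩

theorem mem_of_prefix {a b : Λ.Mor} (hab : Λ.Prefix a b) (hb : b ∈ x.prefixes) :
    a ∈ x.prefixes := by
  have h := hb.1.mono hab.d_le
  have h1 := x.seg_mem_prefixes h
  rwa [(prefix_of_mem h1 hb ((x.d_seg_zero h).trans_le hab.d_le)).unique hab (x.d_seg_zero h)]
    at h1

theorem below_sup {p q : Fin k → ℕ} {m : Fin k → ℕ∞} (hp : Below p m) (hq : Below q m) :
    Below (p ⊔ q) m := fun i => by
  rcases le_total (p i) (q i) with h | h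
  · simpa [h] using hq i
  · simpa [h] using hp i

theorem exists_mem_of_le {a : Λ.Mor} (ha : a ∈ x.prefixes) {n : Fin k → ℕ}
    (hn : Below n x.degree) :
    ∃ b ∈ x.prefixes, Λ.Prefix a b ∧ Λ.d b = Λ.d a ⊔ n := by
  have h := below_sup ha.1 hn
  have hd := x.d_seg_zero h
  exact ⟨_, x.seg_mem_prefixes h,
    prefix_of_mem ha (x.seg_mem_prefixes h) (le_sup_left.trans hd.ge), hd⟩

theorem exists_prefix_prefix {a b : Λ.Mor} (ha : a ∈ x.prefixes) (hb : b ∈ x.prefixes) :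
    ∃ c ∈ x.prefixes, Λ.Prefix a c ∧ Λ.Prefix b c := by
  obtain ⟨c, hc, hac, hd⟩ := exists_mem_of_le ha hb.1
  exact ⟨c, hc, hac, prefix_of_mem hb hc (le_sup_right.trans hd.ge)⟩

theorem ident_range_mem (x : Λ.PathSpace) : Λ.ident x.range ∈ x.prefixes := by
  have := x.seg_mem_prefixes (below_zero _)
  rwa [show x.seg 0 0 (degree_nonneg _) (below_zero _) = Λ.ident x.range from
    x.toMorphism.map_ident ⟨0, below_zero _⟩] at this

theorem r_of_mem {a : Λ.Mor} (ha : a ∈ x.prefixes) : Λ.r a = x.range := by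
  obtain ⟨h, e⟩ := ha
  rw [← e]
  exact x.r_seg _ _

theorem s_of_mem {a : Λ.Mor} (ha : a ∈ x.prefixes) : Λ.s a = x.vertex (Λ.d a) ha.1 := by
  obtain ⟨h, e⟩ := ha
  rw [← x.s_seg (degree_nonneg _) h, e]

theorem comp_mem_prefixes_iff {a b : Λ.Mor} (ha : a ∈ x.prefixes) (h : Λ.s a = Λ.r b) :
    Λ.comp a b h ∈ x.prefixes ↔ ∃ h' : Below (Λ.d a + Λ.d b) x.degree,
      x.seg (Λ.d a) (Λ.d a + Λ.d b) (degree_le_add _ _) h' = b := by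
  constructor
  · intro hab
    have h' : Below (Λ.d a + Λ.d b) x.degree := Λ.d_comp a b h ▸ hab.1
    refine ⟨h', ?_⟩
    have e := eq_seg_of_mem hab (Λ.d_comp a b h) h'
    rw [← x.seg_comp_seg (degree_nonneg _) (degree_le_add _ _) h'] at e
    refine (comp_left_cancel (a := a) (h := h) (h' := ?_) ?_).symm
    · exact (s_of_mem ha).trans (x.r_seg _ _).symm
    · exact e.trans (comp_congr ha.2 rfl _ _)
  · rintro ⟨h', e⟩
    have := x.seg_mem_prefixes h'
    rw [← x.seg_comp_seg (degree_nonneg _) (degree_le_add _ _) h'] at this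
    rwa [comp_congr ha.2 e _ h] at this

theorem ext_prefixes {x y : Λ.PathSpace} (h : x.prefixes = y.prefixes) : x = y := by
  have key : ∀ {x y : Λ.PathSpace}, x.prefixes = y.prefixes → ∀ n : Fin k → ℕ,
      Below n x.degree → Below n y.degree := by
    intro x y h n hn
    have h1 := x.seg_mem_prefixes hn
    rw [h] at h1
    exact x.d_seg_zero hn ▸ h1.1
  have hle : ∀ {x y : Λ.PathSpace}, x.prefixes = y.prefixes → x.degree ≤ y.degree := by
    intro x y h i
    refine ENat.forall_natCast_le_iff_le.mp fun n hn => ?_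
    -- Multiples of the i-th basis vector test the i-th coordinate of the degree alone.
    have := key h (Pi.single i n) fun j => by
      rcases eq_or_ne j i with rfl | hj
      · simpa using hn
      · simp [hj]
    simpa using this i
  refine ext_seg (le_antisymm (hle h) (hle h.symm)) fun p q hpq hq hq' => ?_
  have h0 : ∀ n (hn : Below n x.degree) (hn' : Below n y.degree),
      x.seg 0 n (degree_nonneg _) hn = y.seg 0 n (degree_nonneg _) hn' :=
    fun n hn hn' => eq_seg_of_mem (h ▸ x.seg_mem_prefixes hn) (x.d_seg_zero hn) hn'
  have h1 := h0 q hq hq'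
  rw [← x.seg_comp_seg (degree_nonneg _) hpq, ← y.seg_comp_seg (degree_nonneg _) hpq]
    at h1
  have h2 := h0 p (hq.mono hpq) (hq'.mono hpq)
  refine comp_left_cancel (h := ?_) (h' := ?_)
    (h1.trans (comp_congr h2.symm rfl _ ?_))
  · rw [s_seg, r_seg]
  · rw [h2, s_seg, r_seg]
  · rw [h2, s_seg, r_seg]

theorem mem_prefixes_shift_iff {a b : Λ.Mor} (ha : a ∈ x.prefixes) (h : Λ.s a = Λ.r b) :
    b ∈ (x.shift (Λ.d a) ha.1).prefixes ↔ Λ.comp a b h ∈ x.prefixes := by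
  rw [comp_mem_prefixes_iff ha h]
  constructor
  · rintro ⟨h1, e⟩
    have h2 := ha.1.sub_iff.mp h1
    exact ⟨h2, e⟩
  · rintro ⟨h1, e⟩
    exact ⟨ha.1.sub_iff.mpr h1, e⟩

theorem range_shift {p : Fin k → ℕ} (hp : Below p x.degree) :
    (x.shift p hp).range = x.vertex p hp := by
  change x.vertex (p + 0) _ = _
  rfl

theorem isConcat_iff {a : Λ.Mor} {x y : Λ.PathSpace} :
    IsConcat a x y ↔ ∃ h : a ∈ y.prefixes, y.shift (Λ.d a) h.1 = x :=
  ⟨fun ⟨h, e, e'⟩ => ⟨⟨h, e⟩, e'⟩, fun ⟨⟨h, e⟩, e'⟩ => ⟨h, e, e'⟩⟩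

end PathSpace

/-- The boundary condition on the path `x` at its initial segment `a`. -/
def IsBoundaryAt (x : Λ.PathSpace) (a : Λ.Mor) : Prop :=
  ∀ E ∈ Λ.CE (Λ.s a), ∃ b ∈ E, ∃ h : Λ.s a = Λ.r b, Λ.comp a b h ∈ x.prefixes

theorem isBoundaryPath_iff {x : Λ.PathSpace} :
    IsBoundaryPath x ↔ ∀ a ∈ x.prefixes, IsBoundaryAt x a := by
  constructor
  · intro hx a ha E hE
    rw [PathSpace.s_of_mem ha] at hE
    obtain ⟨b, hb, h, e⟩ := hx _ ha.1 E hE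
    have h' : Λ.s a = Λ.r b := by
      rw [PathSpace.s_of_mem ha, ← e, x.r_seg]
    exact ⟨b, hb, h', (PathSpace.comp_mem_prefixes_iff ha h').mpr ⟨h, e⟩⟩
  · intro hx m hm E hE
    have ha := x.seg_mem_prefixes hm
    have hd := x.d_seg_zero hm
    generalize hseg : x.seg 0 m (degree_nonneg _) hm = a at ha hd
    subst hd
    rw [← PathSpace.s_of_mem ha] at hE
    obtain ⟨b, hb, h', hab⟩ := hx a ha E hE
    obtain ⟨h, e⟩ := (PathSpace.comp_mem_prefixes_iff ha h').mp hab
    exact ⟨b, hb, h, e⟩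

end PathPrefixes

/-! ### Paths from directed sets of finite paths, and concatenation -/

section DirectedSets

variable {Λ : TopologicalKGraph.{u, v} k}

/-- Each coordinate of n is reached by some member of S; directedness merges these finitely many
members into one. -/
theorem below_iSup_degree_iff {S : Set Λ.Mor} (hne : S.Nonempty)
    (hS : DirectedOn Λ.Prefix S) {n : Fin k → ℕ} :
    Below n (fun i => ⨆ c ∈ S, (Λ.d c i : ℕ∞)) ↔ ∃ c ∈ S, n ≤ Λ.d c := by
  constructor
  · intro h
    have h1 : ∀ i, ∃ c ∈ S, n i ≤ Λ.d c i := by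
      intro i
      by_contra! hc
      obtain ⟨c₀, hc₀⟩ := hne
      have h2 : (⨆ c ∈ S, (Λ.d c i : ℕ∞)) ≤ ((n i - 1 : ℕ) : ℕ∞) :=
        iSup₂_le fun c hcS => Nat.cast_le.mpr (Nat.le_sub_one_of_lt (hc c hcS))
      -- With truncated subtraction this only gives n i = 0, which the member `c₀` of S then
      -- excludes.
      have h3 : n i ≤ n i - 1 := Nat.cast_le.mp ((h i).trans h2)
      have h4 := hc c₀ hc₀
      omega
    have h2 : ∀ t : Finset (Fin k), ∃ c ∈ S, ∀ i ∈ t, n i ≤ Λ.d c i := by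
      intro t
      induction t using Finset.induction_on with
      | empty => exact ⟨_, hne.choose_spec, by simp⟩
      | insert i t _ ih =>
        obtain ⟨c, hc, hct⟩ := ih
        obtain ⟨c', hc', hci⟩ := h1 i
        obtain ⟨e, he, hce, hce'⟩ := hS c hc c' hc'
        refine ⟨e, he, fun j hj => ?_⟩
        rcases Finset.mem_insert.mp hj with rfl | hj
        · exact hci.trans (hce'.d_le _)
        · exact (hct j hj).trans (hce.d_le _)
    obtain ⟨c, hc, h⟩ := h2 Finset.univ
    exact ⟨c, hc, fun i => h i (Finset.mem_univ i)⟩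
  · rintro ⟨c, hc, h⟩ i
    exact (Nat.cast_le.mpr (h i)).trans (le_iSup₂ (f := fun c _ => (Λ.d c i : ℕ∞)) c hc)

/-- The initial segments of the members of a directed set of finite paths are those of a path. -/
theorem exists_path_of_directedOn {S : Set Λ.Mor} (hne : S.Nonempty)
    (hS : DirectedOn Λ.Prefix S) :
    ∃ x : Λ.PathSpace, x.prefixes = {a | ∃ c ∈ S, Λ.Prefix a c} := by
  set m : Fin k → ℕ∞ := fun i => ⨆ c ∈ S, (Λ.d c i : ℕ∞) with hm
  have hF : ∀ n : {n : Fin k → ℕ // Below n m}, ∃ a, (∃ c ∈ S, Λ.Prefix a c) ∧ Λ.d a = n.1 := by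
    intro n
    obtain ⟨c, hc, h⟩ := (below_iSup_degree_iff hne hS).mp n.2
    obtain ⟨a, ha, hd⟩ := Prefix.exists_of_le h
    exact ⟨a, ⟨c, hc, ha⟩, hd⟩
  choose F hFS hFd using hF
  have hcoh : ∀ {a b : Λ.Mor}, (∃ c ∈ S, Λ.Prefix a c) → (∃ c ∈ S, Λ.Prefix b c) →
      Λ.d a ≤ Λ.d b → Λ.Prefix a b := by
    rintro a b ⟨c, hc, hac⟩ ⟨c', hc', hbc⟩ hd
    obtain ⟨e, he, h, h'⟩ := hS c hc c' hc'
    exact (hac.trans h).of_le (hbc.trans h') hd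
  have hFp : ∀ {p q : {n : Fin k → ℕ // Below n m}}, p.1 ≤ q.1 →
      ∃ h : Λ.s (F p) = Λ.r (Λ.suf p.1 (F q)), Λ.comp (F p) (Λ.suf p.1 (F q)) h = F q := by
    intro p q hpq
    have := (hcoh (hFS p) (hFS q) (by rwa [hFd, hFd])).comp_suf
    rwa [hFd] at this
  have hs : ∀ {p q : {n : Fin k → ℕ // Below n m}}, p.1 ≤ q.1 →
      Λ.s (Λ.suf p.1 (F q)) = Λ.s (F q) := by
    intro p q hpq
    obtain ⟨h, e⟩ := hFp hpq
    rw [← Λ.s_comp _ _ h, e]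
  -- The segment from p to q is what remains of `F q` once its initial segment `F p` is removed;
  -- functoriality follows by cancelling `F p`.
  let f : GraphMorphism (Omega k m) Λ :=
    { obj := fun p => Λ.s (F p)
      mor := fun a => Λ.suf a.1.1 (F ⟨a.1.2, a.2.2⟩)
      continuous_obj := continuous_of_discreteTopology (α := {q : Fin k → ℕ // Below q _})
      continuous_mor := continuous_of_discreteTopology
        (α := {q : (Fin k → ℕ) × (Fin k → ℕ) // q.1 ≤ q.2 ∧ Below q.2 _})
      map_r := fun a => (hFp (p := ⟨a.1.1, a.2.2.mono a.2.1⟩) (q := ⟨a.1.2, a.2.2⟩) a.2.1).1.symm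
      map_s := fun a => hs (p := ⟨a.1.1, a.2.2.mono a.2.1⟩) (q := ⟨a.1.2, a.2.2⟩) a.2.1
      map_ident := fun p => by
        obtain ⟨h, e⟩ := hFp (le_refl p.1)
        exact comp_left_cancel (h' := (Λ.r_ident _).symm) (e.trans (Λ.comp_ident _).symm)
      map_comp := fun a b h => by
        obtain ⟨⟨p, q⟩, hpq, hq⟩ := a
        obtain ⟨⟨q', t⟩, hqt, ht⟩ := b
        obtain rfl : q = q' := congrArg Subtype.val h
        obtain ⟨h1, e1⟩ := hFp (p := ⟨p, hq.mono hpq⟩) (q := ⟨q, hq⟩) hpq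
        obtain ⟨h2, e2⟩ := hFp (p := ⟨q, hq⟩) (q := ⟨t, ht⟩) hqt
        obtain ⟨h3, e3⟩ := hFp (p := ⟨p, hq.mono hpq⟩) (q := ⟨t, ht⟩) (hpq.trans hqt)
        have h4 : Λ.s (Λ.suf p (F ⟨q, hq⟩)) = Λ.r (Λ.suf q (F ⟨t, ht⟩)) :=
          (hs (p := ⟨p, hq.mono hpq⟩) (q := ⟨q, hq⟩) hpq).trans h2
        refine comp_left_cancel (h := h3) (h' := h1.trans (Λ.r_comp _ _ h4).symm) ?_
        rw [← Λ.assoc _ _ _ h1 h4]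
        exact e3.trans (e2.symm.trans (comp_congr e1.symm rfl _ _))
      map_d := fun a => by
        obtain ⟨⟨p, q⟩, hpq, hq⟩ := a
        obtain ⟨h1, e1⟩ := hFp (p := ⟨p, hq.mono hpq⟩) (q := ⟨q, hq⟩) hpq
        have h2 := congrArg Λ.d e1
        rw [Λ.d_comp, hFd, hFd] at h2
        exact (tsub_eq_of_eq_add_rev h2.symm).symm }
  have hseg : ∀ n (hn : Below n m), (⟨m, f⟩ : Λ.PathSpace).seg 0 n (degree_nonneg n) hn
      = F ⟨n, hn⟩ := by
    intro n hn
    change Λ.suf 0 (F ⟨n, hn⟩) = F ⟨n, hn⟩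
    have := suf_comp (Λ.s_ident (Λ.r (F ⟨n, hn⟩)))
    rwa [Λ.ident_comp, Λ.d_ident] at this
  refine ⟨⟨m, f⟩, Set.ext fun a => ⟨?_, ?_⟩⟩
  · rintro ⟨h, e⟩
    rw [hseg _ h] at e
    rw [← e]
    exact hFS _
  · rintro ⟨c, hc, hac⟩
    have h : Below (Λ.d a) m := (below_iSup_degree_iff hne hS).mpr ⟨c, hc, hac.d_le⟩
    refine ⟨h, (hseg _ h).trans ?_⟩
    exact (hcoh (hFS _) ⟨c, hc, hac⟩ (hFd _).le).unique (Prefix.refl a) (hFd _)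

/-- The concatenation of a finite path with a path exists. -/
theorem exists_isConcat (a : Λ.Mor) (x : Λ.PathSpace) (h : Λ.s a = x.range) :
    ∃ y, IsConcat a x y := by
  have hr : ∀ b : x.prefixes, Λ.s a = Λ.r b.1 := fun b => h.trans (PathSpace.r_of_mem b.2).symm
  obtain ⟨y, hy⟩ := exists_path_of_directedOn (Λ := Λ)
    (S := Set.range fun b : x.prefixes => Λ.comp a b.1 (hr b))
    ⟨_, ⟨_, x.ident_range_mem⟩, rfl⟩ (by
      rintro _ ⟨b, rfl⟩ _ ⟨c, rfl⟩
      obtain ⟨e, he, hbe, hce⟩ := PathSpace.exists_prefix_prefix b.2 c.2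
      exact ⟨_, ⟨⟨e, he⟩, rfl⟩, hbe.comp_left _ _, hce.comp_left _ _⟩)
  have ha : a ∈ y.prefixes := by
    rw [hy]
    exact ⟨_, ⟨⟨_, x.ident_range_mem⟩, rfl⟩, .of_comp _ _ _⟩
  refine ⟨y, PathSpace.isConcat_iff.mpr ⟨ha, PathSpace.ext_prefixes (Set.ext fun b => ?_)⟩⟩
  have hrange : (y.shift (Λ.d a) ha.1).range = x.range := by
    rw [PathSpace.range_shift, ← PathSpace.s_of_mem ha, h]
  constructor
  · intro hb
    have hab : Λ.s a = Λ.r b := by rw [PathSpace.r_of_mem hb, hrange, h]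
    rw [PathSpace.mem_prefixes_shift_iff ha hab, hy] at hb
    obtain ⟨_, ⟨c, rfl⟩, hc⟩ := hb
    exact PathSpace.mem_of_prefix hc.of_comp_left c.2
  · intro hb
    rw [PathSpace.mem_prefixes_shift_iff ha (hr ⟨b, hb⟩), hy]
    exact ⟨_, ⟨⟨b, hb⟩, rfl⟩, .refl _⟩

end DirectedSets

/-! ### Compact alignment and the existence of boundary paths -/

section Compactness

variable {Λ : TopologicalKGraph.{u, v} k}

/-- If a compact set `K` meets every finite path that extends a member of the compact neighbourhood
`U` of `a`, then the remainders of the minimal common extensions form a set in `s(a) CE(Λ)`. -/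
theorem remainders_mem_CE (hΛ : Λ.CompactlyAligned) {a : Λ.Mor} {U K : Set Λ.Mor}
    (hUc : IsCompact U) (hUd : U ⊆ Λ.paths (Λ.d a)) (hU : U ∈ 𝓝 a) (hK : IsCompact K)
    (h : ∀ c ∈ U, ∀ e, Λ.Prefix c e → ∃ b ∈ K, ∃ f, Λ.Prefix e f ∧ Λ.Prefix b f) :
    {α | ∃ c ∈ U, ∃ b ∈ K, ∃ h : Λ.s c = Λ.r α,
      Λ.Prefix b (Λ.comp c α h) ∧ Λ.d (Λ.comp c α h) = Λ.d c ⊔ Λ.d b} ∈ Λ.CE (Λ.s a) := by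
  set E := {α | ∃ c ∈ U, ∃ b ∈ K, ∃ h : Λ.s c = Λ.r α,
      Λ.Prefix b (Λ.comp c α h) ∧ Λ.d (Λ.comp c α h) = Λ.d c ⊔ Λ.d b} with hE
  have hmin : ∀ {c b f}, c ∈ U → b ∈ K → Λ.Prefix c f → Λ.Prefix b f →
      ∃ α ∈ E, ∃ h : Λ.s c = Λ.r α, Λ.Prefix (Λ.comp c α h) f := by
    intro c b f hc hb hcf hbf
    obtain ⟨g, hg, hd⟩ := Prefix.exists_of_le (sup_le hcf.d_le hbf.d_le)
    obtain ⟨α, hα, rfl⟩ := hcf.of_le hg (le_sup_left.trans hd.ge)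
    exact ⟨α, ⟨c, hc, b, hb, hα, hbf.of_le hg (le_sup_right.trans hd.ge), hd⟩, hα, hg⟩
  have hrange : Λ.r '' E = Λ.s '' U := by
    ext w
    constructor
    · rintro ⟨α, ⟨c, hc, b, hb, h, -⟩, rfl⟩
      exact ⟨c, hc, h⟩
    · rintro ⟨c, hc, rfl⟩
      -- The trivial extension of `c` already shows that s(c) is the range of a remainder.
      obtain ⟨b, hb, f, hcf, hbf⟩ := h c hc c (.refl c)
      obtain ⟨α, hα, h', -⟩ := hmin hc hb hcf hbf
      exact ⟨α, hα, h'.symm⟩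
  have hcompact : IsCompact E := by
    -- Compact alignment treats one degree at a time, and a compact set meets only finitely many
    -- degrees.
    have : E = ⋃ q ∈ Λ.d '' K, Λ.suf (Λ.d a) '' Λ.join (Λ.d a) q U (K ∩ Λ.paths q) := by
      ext α
      simp only [Set.mem_iUnion, exists_prop]
      constructor
      · rintro ⟨c, hc, b, hb, h, hbc, hd⟩
        rw [show Λ.d c = Λ.d a from hUd hc] at hd
        refine ⟨Λ.d b, ⟨b, hb, rfl⟩, Λ.comp c α h, ?_, ?_⟩
        · rw [mem_join_iff hUd Set.inter_subset_right]
          exact ⟨hd, ⟨c, hc, .of_comp _ _ _⟩, b, ⟨hb, rfl⟩, hbc⟩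
        · rw [← show Λ.d c = Λ.d a from hUd hc, suf_comp]
      · rintro ⟨q, -, e, he, rfl⟩
        rw [mem_join_iff hUd Set.inter_subset_right] at he
        obtain ⟨hd, ⟨c, hc, α, hα, rfl⟩, b, ⟨hb, rfl⟩, hbe⟩ := he
        rw [← show Λ.d c = Λ.d a from hUd hc, suf_comp]
        refine ⟨c, hc, b, hb, hα, hbe, ?_⟩
        rw [hd, show Λ.d c = Λ.d a from hUd hc]
    rw [this]
    refine (finite_degrees hK).isCompact_biUnion fun q _ => ?_
    refine (hΛ _ _ _ _ hUd Set.inter_subset_right hUc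
      (hK.inter_right (isClosed_paths q))).image_of_continuousOn fun e he => ?_
    rw [mem_join_iff hUd Set.inter_subset_right] at he
    exact (continuousAt_suf (le_sup_left.trans he.1.ge)).continuousWithinAt
  refine ⟨hcompact, ?_, fun b hb => ⟨b, hb, rfl⟩, ?_⟩
  · rw [hrange]
    exact Λ.isLocalHomeomorph_s.isOpenMap.image_mem_nhds hU
  · rintro γ hγ
    rw [hrange] at hγ
    obtain ⟨c, hc, hcγ⟩ := hγ
    -- The path `f` extends both cγ and some cα with α a remainder; cancelling `c` gives a common
    -- extension of γ and α.
    obtain ⟨b, hb, f, hf, hbf⟩ := h c hc _ (.of_comp c γ hcγ)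
    obtain ⟨α, hα, hcα, hαf⟩ := hmin hc hb ((Prefix.of_comp c γ hcγ).trans hf) hbf
    refine ⟨α, hα, minExt_nonempty_iff.mpr ?_⟩
    obtain ⟨δ, hδ, rfl⟩ := (Prefix.of_comp c γ hcγ).trans hf
    exact ⟨δ, hf.of_comp_left, hαf.of_comp_left⟩

/-- A path which satisfies the boundary condition at `a` meets every compact set `K` that cannot be
avoided by the finite paths extending a member of some neighbourhood of `a`. -/
theorem IsBoundaryAt.exists_mem_prefixes (hΛ : Λ.CompactlyAligned) {x : Λ.PathSpace} {a : Λ.Mor}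
    (hxa : IsBoundaryAt x a) {U K : Set Λ.Mor} (hU : U ∈ 𝓝 a) (hK : IsCompact K)
    (h : ∀ c ∈ U, ∀ e, Λ.Prefix c e → ∃ b ∈ K, ∃ f, Λ.Prefix e f ∧ Λ.Prefix b f) :
    ∃ b ∈ K, b ∈ x.prefixes := by
  -- The boundary condition yields a remainder α of some `c` near `a` with s(c) = r(α) = s(a). Local
  -- injectivity of the source map forces c = a, so that cα really is a segment of `x`.
  obtain ⟨V, hV, hinj⟩ : ∃ V ∈ 𝓝 a, Set.InjOn Λ.s V := by
    obtain ⟨φ, ha, hφ⟩ := Λ.isLocalHomeomorph_s a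
    refine ⟨φ.source, φ.open_source.mem_nhds ha, ?_⟩
    rw [hφ]
    exact φ.injOn
  obtain ⟨C, hC, hCs, hCc⟩ := local_compact_nhds
    (Filter.inter_mem (Filter.inter_mem hU hV) ((isOpen_paths (Λ.d a)).mem_nhds rfl))
  obtain ⟨α, ⟨c, hc, b, hb, hcα, hbα, -⟩, haα, hα⟩ := hxa _ (remainders_mem_CE hΛ hCc
    (fun c hc => (hCs hc).2) hC hK fun c hc => h c (hCs hc).1.1)
  obtain rfl : c = a := hinj (hCs hc).1.2 (mem_of_mem_nhds hV) (hcα.trans haα.symm)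
  exact ⟨b, hb, PathSpace.mem_of_prefix hbα hα⟩

/-- Composition on the left carries exhaustiveness of E over to U E, which makes U E a set that
extensions of `a` cannot avoid. -/
theorem exists_prefix_setComp {E : Set Λ.Mor} (hE : Λ.Exhaustive E (Λ.r '' E)) {U : Set Λ.Mor}
    {a e : Λ.Mor} (ha : a ∈ U) (hs : Λ.s a ∈ Λ.r '' E) (hae : Λ.Prefix a e) :
    ∃ b ∈ Λ.setComp U E, ∃ f, Λ.Prefix e f ∧ Λ.Prefix b f := by
  obtain ⟨γ, hγ, rfl⟩ := hae
  obtain ⟨b, hb, hγb⟩ := hE.2 γ (hγ ▸ hs)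
  obtain ⟨f, hγf, hbf⟩ := minExt_nonempty_iff.mp hγb
  have haf : Λ.s a = Λ.r f := hγ.trans hγf.range_eq.symm
  have hab : Λ.s a = Λ.r b := haf.trans hbf.range_eq
  exact ⟨Λ.comp a b hab, ⟨a, ha, b, hb, hab, rfl⟩, Λ.comp a f haf, hγf.comp_left _ _,
    hbf.comp_left _ _⟩

/-- A path with a shift that is a boundary path is a boundary path. -/
theorem isBoundaryPath_of_shift (hΛ : Λ.CompactlyAligned) {x : Λ.PathSpace} {m : Fin k → ℕ}
    (hm : Below m x.degree) (h : IsBoundaryPath (x.shift m hm)) : IsBoundaryPath x := by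
  rw [isBoundaryPath_iff] at h ⊢
  intro a ha E hE
  have hmx := x.seg_mem_prefixes hm
  have hmd := x.d_seg_zero hm
  generalize x.seg 0 m (degree_nonneg m) hm = μ at hmx hmd
  subst hmd
  obtain ⟨c, hc, hac, hμc⟩ := PathSpace.exists_prefix_prefix ha hmx
  -- The hypothesis on the shift only covers segments beyond degree m, so the condition is first
  -- obtained at an extension `c` of `a` and then brought back to `a`.
  have hxc : IsBoundaryAt x c := by
    obtain ⟨γ, hγ, rfl⟩ := hμc
    intro E hE
    rw [Λ.s_comp] at hE
    obtain ⟨b, hb, hγb, hx⟩ := h γ ((PathSpace.mem_prefixes_shift_iff hmx hγ).mpr hc) E hE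
    rw [PathSpace.mem_prefixes_shift_iff hmx (hγ.trans (Λ.r_comp _ _ hγb).symm),
      ← Λ.assoc _ _ _ hγ hγb] at hx
    exact ⟨b, hb, _, hx⟩
  -- A whole neighbourhood of `a` is needed: for paths near `c`, the initial segment of degree d(a)
  -- is only near `a`.
  obtain ⟨C, hC, hCs, hCc⟩ := local_compact_nhds (Filter.inter_mem
    ((isOpen_paths (Λ.d a)).mem_nhds rfl) (Λ.continuous_s.continuousAt.preimage_mem_nhds hE.2.1))
  obtain ⟨_, ⟨a', ha', b, hb, hab, rfl⟩, hx⟩ := hxc.exists_mem_prefixes hΛ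
    (hac.eventually_pre hC) (isCompact_setComp hCc hE.1) fun c' hc' e hce =>
      exists_prefix_setComp hE.2.2 hc'.2 (hCs hc'.2).2 (hc'.1.trans hce)
  have ha'x := PathSpace.mem_of_prefix (.of_comp _ _ _) hx
  have hd : Λ.d a' = Λ.d a := (hCs ha').1
  obtain rfl : a' = a := (PathSpace.prefix_of_mem ha'x ha hd.le).unique (.refl _) hd
  exact ⟨b, hb, hab, hx⟩

/-- Common extensions of the c ∈ S with members of K, suitably truncated, converge along an
ultrafilter to a coherent family of paths e(c). Their initial segments form a directed set
containing S, hence equal to S by maximality, and some member of K is among them. -/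
theorem directed_maximal_inter_nonempty (hΛ : Λ.CompactlyAligned) {S K : Set Λ.Mor}
    (hne : S.Nonempty) (hS : DirectedOn Λ.Prefix S)
    (hmax : ∀ D, DirectedOn Λ.Prefix D → S ⊆ D → D ⊆ S) (hK : IsCompact K)
    (h : ∀ c ∈ S, ∃ b ∈ K, ∃ f, Λ.Prefix c f ∧ Λ.Prefix b f) : (S ∩ K).Nonempty := by
  choose! g hgK f hcf hgf using h
  let _ : Preorder S :=
    { le := fun a b => Λ.Prefix a.1 b.1
      le_refl := fun a => .refl a.1
      le_trans := fun _ _ _ => .trans }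
  have : IsDirectedOrder S := ⟨fun a b => by
    obtain ⟨c, hc, h⟩ := hS a.1 a.2 b.1 b.2
    exact ⟨⟨c, hc⟩, h⟩⟩
  have : Nonempty S := hne.to_subtype
  -- Refining `atTop` ensures that almost every index extends any given c ∈ S; being an ultrafilter
  -- makes all the limits exist along the same filter.
  let 𝓤 : Ultrafilter S := Ultrafilter.of Filter.atTop
  have h𝓤 : (𝓤 : Filter S) ≤ Filter.atTop := Ultrafilter.of_le _
  obtain ⟨b, hbK, hb⟩ := hK.ultrafilter_le_nhds (𝓤.map fun c : S => g c.1)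
    (Filter.le_principal_iff.mpr (Filter.mem_map.mpr (Filter.univ_mem' fun c => hgK c.1 c.2)))
  have hgd : ∀ᶠ c : S in 𝓤, Λ.d (g c.1) = Λ.d b :=
    (show Filter.Tendsto (fun c : S => g c.1) 𝓤 (𝓝 b) from hb).eventually
      ((isOpen_paths (Λ.d b)).mem_nhds rfl)
  -- For fixed `c` the truncations to degree d(c) ∨ d(b) eventually lie in one join, compact by
  -- compact alignment.
  have hlim : ∀ c : S, ∃ e ∈ Λ.join (Λ.d c.1) (Λ.d b) {c.1} (K ∩ Λ.paths (Λ.d b)),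
      Filter.Tendsto (fun c' : S => Λ.pre (Λ.d c.1 ⊔ Λ.d b) (f c'.1)) 𝓤 (𝓝 e) := by
    intro c
    have hsub : ({c.1} : Set Λ.Mor) ⊆ Λ.paths (Λ.d c.1) := by
      rintro _ rfl
      rfl
    refine (hΛ _ _ _ _ hsub Set.inter_subset_right isCompact_singleton
      (hK.inter_right (isClosed_paths _))).ultrafilter_le_nhds
      (𝓤.map fun c' => Λ.pre (Λ.d c.1 ⊔ Λ.d b) (f c'.1))
      (Filter.le_principal_iff.mpr (Filter.mem_map.mpr ?_))
    filter_upwards [hgd, h𝓤 (Filter.eventually_ge_atTop c)] with c' hd hcc'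
    have h1 : Λ.Prefix c.1 (f c'.1) := Prefix.trans hcc' (hcf c'.1 c'.2)
    have h2 := hgf c'.1 c'.2
    have hle : Λ.d c.1 ⊔ Λ.d b ≤ Λ.d (f c'.1) := sup_le h1.d_le (hd ▸ h2.d_le)
    rw [Set.mem_preimage, mem_join_iff hsub Set.inter_subset_right]
    exact ⟨d_pre hle, ⟨c.1, rfl, h1.of_le (pre_prefix hle) (le_sup_left.trans (d_pre hle).ge)⟩,
      g c'.1, ⟨hgK c'.1 c'.2, hd⟩,
      h2.of_le (pre_prefix hle) (hd.trans_le (le_sup_right.trans (d_pre hle).ge))⟩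
  choose e hej he using hlim
  have hej' : ∀ c : S, Λ.d (e c) = Λ.d c.1 ⊔ Λ.d b ∧ Λ.Prefix c.1 (e c) ∧
      ∃ b' ∈ K, Λ.Prefix b' (e c) := by
    intro c
    obtain ⟨h1, ⟨_, rfl, h2⟩, b', hb', h3⟩ := (mem_join_iff
      (by rintro _ rfl; rfl) Set.inter_subset_right).mp (hej c)
    exact ⟨h1, h2, b', hb'.1, h3⟩
  have hmono : ∀ c c' : S, c ≤ c' → Λ.Prefix (e c) (e c') := by
    intro c c' hcc'
    have hn : Λ.d c.1 ⊔ Λ.d b ≤ Λ.d c'.1 ⊔ Λ.d b := sup_le_sup_right (Prefix.d_le hcc') _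
    have hle : Λ.d c.1 ⊔ Λ.d b ≤ Λ.d (e c') := hn.trans (hej' c').1.ge
    have h1 := (continuousAt_pre hle).tendsto.comp (he c')
    have h2 : Λ.pre (Λ.d c.1 ⊔ Λ.d b) (e c') = e c := by
      refine tendsto_nhds_unique h1 ((he c).congr' ?_)
      filter_upwards [hgd, h𝓤 (Filter.eventually_ge_atTop c')] with c'' hd hcc''
      have h3 : Λ.d c'.1 ⊔ Λ.d b ≤ Λ.d (f c''.1) := sup_le
        (Prefix.d_le hcc'' |>.trans (hcf c''.1 c''.2).d_le) (hd ▸ (hgf c''.1 c''.2).d_le)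
      have h4 : Λ.d c.1 ⊔ Λ.d b ≤ Λ.d (Λ.pre (Λ.d c'.1 ⊔ Λ.d b) (f c''.1)) :=
        hn.trans (d_pre h3).ge
      exact (pre_prefix (hn.trans h3)).unique ((pre_prefix h4).trans (pre_prefix h3))
        ((d_pre (hn.trans h3)).trans (d_pre h4).symm)
    rw [← h2]
    exact pre_prefix hle
  have hD : DirectedOn Λ.Prefix {a | ∃ c, Λ.Prefix a (e c)} := by
    rintro a ⟨c, hc⟩ a' ⟨c', hc'⟩
    obtain ⟨c'', h, h'⟩ := exists_ge_ge c c'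
    exact ⟨e c'', ⟨c'', .refl _⟩, hc.trans (hmono _ _ h), hc'.trans (hmono _ _ h')⟩
  obtain ⟨c⟩ := ‹Nonempty S›
  obtain ⟨b', hb', hb'e⟩ := (hej' c).2.2
  exact ⟨b', hmax _ hD (fun c hc => ⟨⟨c, hc⟩, (hej' ⟨c, hc⟩).2.1⟩) ⟨c, hb'e⟩, hb'⟩

/-- Every vertex is the range of a boundary path. -/
theorem exists_isBoundaryPath (hΛ : Λ.CompactlyAligned) (w : Λ.Obj) :
    ∃ x : Λ.PathSpace, IsBoundaryPath x ∧ x.range = w := by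
  obtain ⟨S, hwS, hmax⟩ := zorn_subset_nonempty {S | DirectedOn Λ.Prefix S}
    (fun C hC hC' _ => ⟨⋃₀ C, Set.directedOn_sUnion hC'.directedOn hC, fun _ => Set.subset_sUnion_of_mem⟩) {Λ.ident w}
    (by rintro _ rfl _ rfl; exact ⟨_, rfl, .refl _, .refl _⟩)
  have hS : DirectedOn Λ.Prefix S := hmax.prop
  have hw : Λ.ident w ∈ S := hwS rfl
  have hmax' : ∀ D, DirectedOn Λ.Prefix D → S ⊆ D → D ⊆ S := fun D hD h =>
    hmax.le_of_ge hD h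
  obtain ⟨x, hx⟩ := exists_path_of_directedOn ⟨_, hw⟩ hS
  -- The initial segments of members of S again form a directed set, so maximality makes S closed
  -- under initial segments.
  have hxS : x.prefixes = S := by
    rw [hx]
    refine Set.Subset.antisymm (hmax' _ ?_ fun c hc => ⟨c, hc, .refl c⟩) fun c hc => ⟨c, hc, .refl c⟩
    rintro a ⟨c, hc, hac⟩ a' ⟨c', hc', hac'⟩
    obtain ⟨e, he, h, h'⟩ := hS c hc c' hc'
    exact ⟨e, ⟨e, he, .refl e⟩, hac.trans h, hac'.trans h'⟩
  refine ⟨x, isBoundaryPath_iff.mpr fun a ha E hE => ?_, ?_⟩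
  · rw [hxS] at ha ⊢
    obtain ⟨_, hcS, a', rfl, b, hb, h, rfl⟩ := directed_maximal_inter_nonempty hΛ ⟨_, hw⟩ hS hmax'
      (isCompact_setComp (isCompact_singleton (x := a)) hE.1) fun c hc => by
        obtain ⟨e, he, hae, hce⟩ := hS a ha c hc
        obtain ⟨b, hb, f, hef, hbf⟩ :=
          exists_prefix_setComp hE.2.2 (Set.mem_singleton a) (mem_of_mem_nhds hE.2.1) hae
        exact ⟨b, hb, f, hce.trans hef, hbf⟩
    exact ⟨b, hb, h, hcS⟩
  · rw [← PathSpace.r_of_mem (hxS ▸ hw), Λ.r_ident]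

end Compactness

/-! ### Aperiodicity, neighbourhoods of units and isotropy -/

section Main

variable {Λ : TopologicalKGraph.{u, v} k}

/-- A path with an aperiodic shift is aperiodic. -/
theorem aperiodic_of_shift {x : Λ.PathSpace} {m : Fin k → ℕ} (hm : Below m x.degree)
    (h : Aperiodic (x.shift m hm)) : Aperiodic x := by
  intro p q hp hq hpq e
  have hdeg : ∀ i, x.degree i - p i = x.degree i - q i := congrFun (congrArg PathSpace.degree e)
  -- The two shifts have equal degrees, so p and q can differ only where the degree is infinite.
  have hpq' : ∀ i, x.degree i = ⊤ ∨ p i = q i := by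
    intro i
    have h1 := hdeg i
    have h2 := hp i
    have h3 := hq i
    generalize x.degree i = t at *
    induction t using ENat.recTopCoe with
    | top => exact .inl rfl
    | coe t =>
      norm_cast at *
      omega
  -- This t moves both p and q past m. It stays below the degree: where that is finite, p i = q i
  -- and both become m i ⊔ p i.
  let t : Fin k → ℕ := fun i => m i - (p i ⊓ q i)
  have ht : ∀ i, ((p i + t i : ℕ) : ℕ∞) ≤ x.degree i ∧ ((q i + t i : ℕ) : ℕ∞) ≤ x.degree i := by
    intro i
    rcases hpq' i with h1 | h1
    · simp [h1]
    · have h2 : p i + t i = m i ⊔ p i := by simp only [t]; omega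
      have h3 : q i + t i = m i ⊔ p i := by simp only [t]; omega
      have h4 := PathSpace.below_sup hm hp i
      rw [h2, h3]
      exact ⟨h4, h4⟩
  have hpt : Below (p + t) x.degree := fun i => (ht i).1
  have hqt : Below (q + t) x.degree := fun i => (ht i).2
  have hmp : m + (p + t - m) = p + t := by
    funext i
    simp only [t, Pi.add_apply, Pi.sub_apply]
    omega
  have hmq : m + (q + t - m) = q + t := by
    funext i
    simp only [t, Pi.add_apply, Pi.sub_apply]
    omega
  have hmpt : Below (p + t - m) (x.shift m hm).degree := hm.sub_iff.mpr (hmp.symm ▸ hpt)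
  have hmqt : Below (q + t - m) (x.shift m hm).degree := hm.sub_iff.mpr (hmq.symm ▸ hqt)
  have hpt' : Below t (x.shift p hp).degree := hp.sub_iff.mpr hpt
  have hqt' : Below t (x.shift q hq).degree := hq.sub_iff.mpr hqt
  refine h (p + t - m) (q + t - m) hmpt hmqt (fun h1 => ?_) ?_
  · rw [h1, hmq] at hmp
    exact hpq (add_right_cancel hmp.symm)
  · rw [PathSpace.shift_shift, PathSpace.shift_shift, PathSpace.shift_congr rfl hmp _ hpt,
      PathSpace.shift_congr rfl hmq _ hqt, ← PathSpace.shift_shift x p t hp hpt',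
      ← PathSpace.shift_shift x q t hq hqt']
    exact PathSpace.shift_congr e rfl _ _

/-- Two initial segments of one path with equal degrees coincide, so a unit only sees the diagonal
of F. -/
theorem unit_mem_cylinder_iff {F : Set (Λ.Mor × Λ.Mor)} {m : Fin k → ℤ} {x : Λ.PathSpace} :
    GroupoidElement.unit x ∈ cylinder F m ↔ m = 0 ∧ ∃ a ∈ x.prefixes, (a, a) ∈ F := by
  constructor
  · rintro ⟨h, a, b, hab, hd, z, ha, hb⟩
    have hm : m = 0 := h.symm
    subst hm
    have ha' := (PathSpace.isConcat_iff.mp ha).1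
    have hb' := (PathSpace.isConcat_iff.mp hb).1
    have hd' : Λ.d a = Λ.d b := funext fun i => by
      have := congrFun hd i
      simp only [Pi.zero_apply] at this
      omega
    obtain rfl : a = b := (PathSpace.prefix_of_mem ha' hb' hd'.le).unique (.refl b) hd'
    exact ⟨rfl, a, ha', hab⟩
  · rintro ⟨rfl, a, ha, haF⟩
    exact ⟨rfl, a, a, haF, funext fun i => sub_self _, _,
      PathSpace.isConcat_iff.mpr ⟨ha, rfl⟩, PathSpace.isConcat_iff.mpr ⟨ha, rfl⟩⟩

/-- A neighbourhood of the unit at `x` contains the units at all paths which have an initial segment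
close to one of `x` and avoid a compact set avoided by `x`. -/
theorem exists_nhds_of_unit_mem {O : Set (GroupoidElement Λ.PathSpace)} (hO : IsOpen O)
    {x : Λ.PathSpace} (hx : GroupoidElement.unit x ∈ O) :
    ∃ a ∈ x.prefixes, ∃ W ∈ 𝓝 a, ∃ K : Set Λ.Mor, IsCompact K ∧ Disjoint K x.prefixes ∧
      ∀ y : Λ.PathSpace, (∃ b ∈ W, b ∈ y.prefixes) → Disjoint K y.prefixes →
        GroupoidElement.unit y ∈ O := by
  induction hO with
  | basic S hS =>
    obtain ⟨m, U, V, F, hU, hV, hFs, hF, rfl⟩ := hS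
    obtain ⟨hx1, hx2⟩ := hx
    obtain ⟨rfl, a, ha, ⟨haU, haV⟩, -⟩ := unit_mem_cylinder_iff.mp hx1
    have hdiag : (fun a : Λ.Mor => (a, a)) ⁻¹' F = Prod.fst '' (F ∩ Set.diagonal Λ.Mor) := by
      ext b
      constructor
      · exact fun hb => ⟨(b, b), ⟨hb, rfl⟩, rfl⟩
      · rintro ⟨⟨b, c⟩, ⟨hb, hbc⟩, rfl⟩
        obtain rfl : b = c := hbc
        exact hb
    have hFc : IsCompact ((fun a : Λ.Mor => (a, a)) ⁻¹' F) :=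
      hdiag ▸ (hF.inter_right isClosed_diagonal).image continuous_fst
    have hK : ∀ y : Λ.PathSpace, Disjoint ((fun a : Λ.Mor => (a, a)) ⁻¹' F) y.prefixes ↔
        GroupoidElement.unit y ∉ cylinder F 0 := by
      intro y
      rw [unit_mem_cylinder_iff, Set.disjoint_left]
      constructor
      · rintro h ⟨-, b, hb, hbF⟩
        exact h hbF hb
      · exact fun h b hbF hb => h ⟨rfl, b, hb, hbF⟩
    refine ⟨a, ha, U ∩ V, (hU.inter hV).mem_nhds ⟨haU, haV⟩, _, hFc,
      (hK x).mpr hx2, ?_⟩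
    rintro y ⟨b, ⟨hbU, hbV⟩, hb⟩ hy
    exact ⟨unit_mem_cylinder_iff.mpr ⟨rfl, b, hb, ⟨hbU, hbV⟩, rfl⟩, (hK y).mp hy⟩
  | univ =>
    exact ⟨_, x.ident_range_mem, Set.univ, Filter.univ_mem, ∅, isCompact_empty,
      Set.empty_disjoint _, fun _ _ _ => trivial⟩
  | inter O O' _ _ ih ih' =>
    obtain ⟨a, ha, W, hW, K, hK, hKx, h⟩ := ih hx.1
    obtain ⟨a', ha', W', hW', K', hK', hKx', h'⟩ := ih' hx.2
    obtain ⟨c, hc, hac, hac'⟩ := PathSpace.exists_prefix_prefix ha ha'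
    -- The new neighbourhood consists of paths near `c` whose truncations to degrees d(a) and d(a')
    -- lie in W and W'.
    refine ⟨c, hc, _, (hac.eventually_pre hW).and (hac'.eventually_pre hW'), K ∪ K', hK.union hK',
      hKx.union_left hKx', ?_⟩
    rintro y ⟨e, ⟨⟨he1, he2⟩, he1', he2'⟩, hey⟩ hy
    rw [Set.disjoint_union_left] at hy
    exact ⟨h y ⟨_, he2, PathSpace.mem_of_prefix he1 hey⟩ hy.1,
      h' y ⟨_, he2', PathSpace.mem_of_prefix he1' hey⟩ hy.2⟩
  | sUnion 𝒮 _ ih =>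
    obtain ⟨O, hO, hxO⟩ := hx
    obtain ⟨a, ha, W, hW, K, hK, hKx, h⟩ := ih O hO hxO
    exact ⟨a, ha, W, hW, K, hK, hKx, fun y hy hy' => ⟨O, hO, h y hy hy'⟩⟩

/-- For compact `K`, the finite paths that have no common extension with a member of `K` form an open
set. -/
theorem eventually_forall_not_prefix (hΛ : Λ.CompactlyAligned) {K : Set Λ.Mor} (hK : IsCompact K)
    {a : Λ.Mor} (ha : ∀ b ∈ K, ∀ f, Λ.Prefix a f → ¬ Λ.Prefix b f) :
    ∀ᶠ c in 𝓝 a, ∀ b ∈ K, ∀ f, Λ.Prefix c f → ¬ Λ.Prefix b f := by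
  obtain ⟨U, hU, hUs, hUc⟩ := local_compact_nhds ((isOpen_paths (Λ.d a)).mem_nhds rfl)
  -- Within U, the paths compatible with K are those in this compact, hence closed, set of truncated
  -- common extensions.
  have hT : IsCompact
      (⋃ q ∈ Λ.d '' K, Λ.pre (Λ.d a) '' Λ.join (Λ.d a) q U (K ∩ Λ.paths q)) := by
    refine (finite_degrees hK).isCompact_biUnion fun q _ => ?_
    refine (hΛ _ _ _ _ hUs Set.inter_subset_right hUc
      (hK.inter_right (isClosed_paths q))).image_of_continuousOn fun e he => ?_
    rw [mem_join_iff hUs Set.inter_subset_right] at he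
    exact (continuousAt_pre (le_sup_left.trans he.1.ge)).continuousWithinAt
  have hmem : ∀ c ∈ U, (c ∈ ⋃ q ∈ Λ.d '' K, Λ.pre (Λ.d a) ''
      Λ.join (Λ.d a) q U (K ∩ Λ.paths q)) ↔ ∃ b ∈ K, ∃ f, Λ.Prefix c f ∧ Λ.Prefix b f := by
    intro c hc
    have hcd : Λ.d c = Λ.d a := hUs hc
    simp only [Set.mem_iUnion, exists_prop]
    constructor
    · rintro ⟨q, -, e, he, rfl⟩
      rw [mem_join_iff hUs Set.inter_subset_right] at he
      obtain ⟨hd, -, b, ⟨hb, -⟩, hbe⟩ := he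
      exact ⟨b, hb, e, pre_prefix (le_sup_left.trans hd.ge), hbe⟩
    · rintro ⟨b, hb, f, hcf, hbf⟩
      obtain ⟨e, he, hd⟩ := Prefix.exists_of_le (sup_le hcf.d_le hbf.d_le)
      have hce := hcf.of_le he (le_sup_left.trans hd.ge)
      refine ⟨Λ.d b, ⟨b, hb, rfl⟩, e, ?_, by rw [← hcd, hce.pre_eq]⟩
      rw [mem_join_iff hUs Set.inter_subset_right, ← hcd]
      exact ⟨hd, ⟨c, hc, hce⟩, b, ⟨hb, rfl⟩, hbf.of_le he (le_sup_right.trans hd.ge)⟩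
  have haT := hT.isClosed.isOpen_compl.mem_nhds (x := a) fun h => by
    obtain ⟨b, hb, f, haf, hbf⟩ := (hmem a (mem_of_mem_nhds hU)).mp h
    exact ha b hb f haf hbf
  filter_upwards [hU, haT] with c hc hcT b hb f hcf hbf
  exact hcT ((hmem c hc).mpr ⟨b, hb, f, hcf, hbf⟩)

/-- Under condition (A), aperiodic boundary paths occur near every boundary path. -/
theorem ConditionA.exists_aperiodic (hΛ : Λ.CompactlyAligned) (hA : Λ.ConditionA)
    {x : Λ.PathSpace} (hx : IsBoundaryPath x) {a : Λ.Mor} (ha : a ∈ x.prefixes) {W K : Set Λ.Mor}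
    (hW : W ∈ 𝓝 a) (hK : IsCompact K) (hKx : Disjoint K x.prefixes) :
    ∃ y : Λ.PathSpace, IsBoundaryPath y ∧ Aperiodic y ∧ (∃ b ∈ W, b ∈ y.prefixes) ∧
      Disjoint K y.prefixes := by
  -- Otherwise K could not be avoided near `a`, and the boundary condition would give `x` an initial
  -- segment in K. The interior keeps W a neighbourhood of `c`.
  obtain ⟨c, hc, e, hce, hKe⟩ : ∃ c ∈ interior W, ∃ e, Λ.Prefix c e ∧
      ∀ b ∈ K, ∀ f, Λ.Prefix e f → ¬ Λ.Prefix b f := by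
    by_contra! hcon
    obtain ⟨b, hb, hbx⟩ :=
      (isBoundaryPath_iff.mp hx a ha).exists_mem_prefixes hΛ (interior_mem_nhds.mpr hW) hK
        fun c hc e hce => hcon c hc e hce
    exact Set.disjoint_left.mp hKx hb hbx
  obtain ⟨O, hO, hOo, heO⟩ := eventually_nhds_iff.mp ((eventually_forall_not_prefix hΛ hK hKe).and
    (hce.eventually_pre (mem_interior_iff_mem_nhds.mp hc)))
  obtain ⟨z, hz, ⟨e', he', hez⟩, hzA⟩ := hA (Λ.s '' O)
    (Λ.isLocalHomeomorph_s.isOpenMap O hOo) ⟨_, e, heO, rfl⟩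
  obtain ⟨y, hy⟩ := exists_isConcat e' z hez
  obtain ⟨he'y, rfl⟩ := PathSpace.isConcat_iff.mp hy
  obtain ⟨hKe', hpre, hW'⟩ := hO e' he'
  refine ⟨y, isBoundaryPath_of_shift hΛ _ hz, aperiodic_of_shift _ hzA,
    ⟨_, hW', PathSpace.mem_of_prefix hpre he'y⟩, Set.disjoint_left.mpr fun b hb hby => ?_⟩
  -- A segment of `y` in K would have a common extension with `e'`.
  obtain ⟨f, -, hef, hbf⟩ := PathSpace.exists_prefix_prefix he'y hby
  exact hKe' b hb f hef hbf

/-- A coincidence of shifts σ^p x = σ^q x is the same thing as an isotropy element of degree p - q,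
which is a unit only for p = q. -/
theorem aperiodic_iff (x : Λ.BoundaryPath) :
    {γ : GroupoidElement Λ.BoundaryPath | γ.range = x ∧ γ.source = x} = {GroupoidElement.unit x} ↔
      Aperiodic x.1 := by
  constructor
  · intro h p q hp hq hpq e
    have h1 : (⟨x, x, ⟨fun i => (p i : ℤ) - q i, p, q, hp, hq, rfl, e⟩⟩ :
        GroupoidElement Λ.BoundaryPath) = GroupoidElement.unit x := h.subset ⟨rfl, rfl⟩
    have h2 : (fun i => (p i : ℤ) - q i) = 0 :=
      congrArg (fun γ : GroupoidElement Λ.BoundaryPath => γ.arrow.1) h1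
    refine hpq (funext fun i => ?_)
    have := congrFun h2 i
    simp only [Pi.zero_apply] at this
    omega
  · intro h
    refine Set.Subset.antisymm ?_ ?_
    · rintro ⟨_, _, ⟨n, p, q, hp, hq, rfl, e⟩⟩ ⟨h1, h2⟩
      dsimp only at h1 h2
      subst h1
      obtain rfl := h2
      obtain rfl : p = q := by
        by_contra hpq
        exact h p q hp hq hpq e
      have : (fun i => (p i : ℤ) - p i) = 0 := funext fun i => sub_self _
      simp only [this]
      rfl
    · rintro _ rfl
      exact ⟨rfl, rfl⟩

end Main

end TopologicalKGraph

/-! ### The equivalence -/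

open TopologicalKGraph in
theorem mainTheorem2 {k : ℕ} (Λ : TopologicalKGraph.{u, v} k) (hΛ : Λ.CompactlyAligned) :
    GroupoidElement.EssentiallyFree Λ.BoundaryPath ↔ Λ.ConditionA := by
  constructor
  · intro h V hV hVne
    -- All initial segments of a path share its range, so the generating set given by U, U and F = ∅
    -- picks out exactly the units with range in V.
    let U : Set Λ.Mor := Λ.r ⁻¹' V
    have hU : IsOpen U := hV.preimage Λ.continuous_r
    have hmem : ∀ x : Λ.PathSpace,
        GroupoidElement.unit x ∈ cylinder (Λ.starS U U) 0 ∩ (cylinder ∅ 0)ᶜ ↔ x.range ∈ V := by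
      intro x
      rw [Set.mem_inter_iff, Set.mem_compl_iff, unit_mem_cylinder_iff, unit_mem_cylinder_iff]
      constructor
      · rintro ⟨⟨-, a, ha, ⟨haU, -⟩, -⟩, -⟩
        rwa [← PathSpace.r_of_mem ha]
      · intro hx
        have hx' : Λ.ident x.range ∈ U := by rwa [Set.mem_preimage, Λ.r_ident]
        exact ⟨⟨rfl, _, x.ident_range_mem, ⟨hx', hx'⟩, rfl⟩, by simp⟩
    have hopen : IsOpen (cylinder (Λ.starS U U) 0 ∩ (cylinder ∅ 0)ᶜ) :=
      TopologicalSpace.isOpen_generateFrom_of_mem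
        ⟨0, U, U, ∅, hU, hU, Set.empty_subset _, isCompact_empty, rfl⟩
    obtain ⟨w, hw⟩ := hVne
    obtain ⟨x, hx, rfl⟩ := exists_isBoundaryPath hΛ w
    obtain ⟨⟨_, ⟨y, rfl⟩⟩, hy, hyO⟩ := h.exists_mem_open
      ((hopen.preimage continuous_induced_dom).preimage continuous_subtype_val)
      ⟨⟨GroupoidElement.unit ⟨x, hx⟩, ⟨⟨x, hx⟩, rfl⟩⟩, (hmem x).mpr hw⟩
    exact ⟨y.1, y.2, (hmem y.1).mp hyO, (aperiodic_iff y).mp hy⟩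
  · intro hA
    refine dense_iff_inter_open.mpr ?_
    rintro _ ⟨_, ⟨O, hO, rfl⟩, rfl⟩ ⟨⟨_, ⟨x, rfl⟩⟩, hxO⟩
    obtain ⟨a, ha, W, hW, K, hK, hKx, h⟩ := exists_nhds_of_unit_mem hO (x := x.1) hxO
    obtain ⟨y, hy, hyA, hyW, hyK⟩ := hA.exists_aperiodic hΛ x.2 ha hW hK hKx
    exact ⟨⟨GroupoidElement.unit ⟨y, hy⟩, ⟨⟨y, hy⟩, rfl⟩⟩, h y hyW hyK,
      (aperiodic_iff ⟨y, hy⟩).mpr hyA⟩
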